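/- **Theorem.** For $n\ge 0$ let $S_n(1342)$ be the number of permutations $p$ of $\{1,\dots,n\}$ that avoid the pattern $1342$, i.e. for which there are no positions $i_1<i_2<i_3<i_4$ with $p(i_1)<p(i_4)<p(i_2)<p(i_3)$ (so $S_0(1342)=1$), and let $H(x)=\sum_{n\ge 0}S_n(1342)\,x^n\in\mathbb C[[x]]$ be the ordinary generating function. Then: 1. The sequence $S_n(1342)$ is $P$-recursive: there are an integer $k\ge 0$ and polynomials $P_0,\dots,P_k\in\mathbb Q[n]$ with $P_k\ne 0$ such that $$P_k(n)\,S_{n+k}(1342)+P_{k-1}(n)\,S_{n+k-1}(1342)+\cdots+P_0(n)\,S_n(1342)=0\qquad\text{for all integers } n\ge 0.$$ 2. $H(x)$ is algebraic over $\mathbb C[x]$: there are $d\ge 1$ and $p_0,\dots,p_d\in\mathbb C[x]$ with $p_d\neq 0$ and $p_d(x)H(x)^d+\cdots+p_1(x)H(x)+p_0(x)=0$. 3. The only irrationality of $H(x)$ is $\sqrt{1-8x}$: with $\sqrt{1-8x}\in\mathbb C[[x]]$ denoting the power series with constant term $1$ whose square is $1-8x$, the series $H(x)$ is not a rational function, i.e.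 $D\,H\ne A$ for all polynomials $A,D\in\mathbb C[x]$ with $D\neq 0$, while $$D(x)\,H(x)=A(x)+B(x)\sqrt{1-8x}\qquad\text{for some } A,B,D\in\mathbb C[x],\ D\ne 0.$$ -/

import Mathlib

open scoped Polynomial PowerSeries

/-- The permutation `p` of length `n` contains the pattern `q` of length `k`: there are positions
`e 0 < e 1 < ... < e (k - 1)` at which the entries of `p` are in the same relative order as the
entries of `q`. -/
def ContainsPattern {n k : ℕ} (p : Equiv.Perm (Fin n)) (q : Equiv.Perm (Fin k)) : Prop :=
  ∃ e : Fin k → Fin n, StrictMono e ∧ ∀ i j : Fin k, p (e i) < p (e j) ↔ q i < q j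

/-- The number `S_n(q)` of permutations of length `n` that avoid the pattern `q`. -/
noncomputable def avoidCount {k : ℕ} (q : Equiv.Perm (Fin k)) (n : ℕ) : ℕ :=
  Nat.card {p : Equiv.Perm (Fin n) // ¬ ContainsPattern p q}

/-- The pattern 1342, with positions and entries shifted down by one so as to start at `0`. -/
def pattern1342 : Equiv.Perm (Fin 4) where
  toFun := ![0, 2, 3, 1]
  invFun := ![0, 3, 1, 2]
  left_inv := by decide
  right_inv := by decide

/-- `f` is P-recursive (polynomially recursive): for some `k` and polynomials `P 0, ..., P k` over
`ℚ` with `P k ≠ 0`, one has `P k (n) f(n + k) + ... + P 0 (n) f(n) = 0` for all `n`. -/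
def IsPRecursive (f : ℕ → ℂ) : Prop :=
  ∃ (k : ℕ) (P : ℕ → ℚ[X]), P k ≠ 0 ∧
    ∀ n : ℕ, ∑ j ∈ Finset.range (k + 1), Polynomial.aeval (n : ℂ) (P j) * f (n + j) = 0

/-- The power series `u` is (the expansion of) a rational function. -/
def IsRationalSeries (u : ℂ⟦X⟧) : Prop :=
  ∃ A D : ℂ[X], D ≠ 0 ∧ (D : ℂ⟦X⟧) * u = (A : ℂ⟦X⟧)

/-- `r` is the power series `√(1 - 8x)`: its square is `1 - 8x` and its constant term is `1`. -/
def IsSqrtOneSubEight (r : ℂ⟦X⟧) : Prop :=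
  PowerSeries.constantCoeff r = 1 ∧ r ^ 2 = 1 - 8 * PowerSeries.X

/-- The power series `r` is the only irrationality of `u`: `u` is not rational, but
`u = (A + B r) / D` for some polynomials `A`, `B` and `D ≠ 0`. -/
def IsOnlyQuadraticIrrationality (r u : ℂ⟦X⟧) : Prop :=
  ¬ IsRationalSeries u ∧
    ∃ A B D : ℂ[X], D ≠ 0 ∧ (D : ℂ⟦X⟧) * u = (A : ℂ⟦X⟧) + (B : ℂ⟦X⟧) * r

/-- The generating function `H(x) = ∑_{n ≥ 0} S_n(1342) x^n`. -/
noncomputable def genFun1342 : ℂ⟦X⟧ :=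
  PowerSeries.mk fun n => (avoidCount pattern1342 n : ℂ)

open Finset

/-!
The proof computes the generating function in closed form,
`2 (1 + x)³ H(x) = 1 + 20 x - 8 x² + (1 - 8 x) √(1 - 8 x)`,
from which all three claims follow: squaring gives an algebraic equation, differentiating gives a
linear differential equation of first order and with it a three-term recurrence, and `√(1 - 8 x)` is
not rational because the degree of `1 - 8 x` is odd.

Permutations are treated as words on finite sets of natural numbers. A word `L ++ M :: R` with
maximum `M` avoids 1342 if and only if `L` and `R` do, no entry of `R` lies in value between two
entries of `L` that are in increasing order, and the entries of `R` above any entry of `L` avoid 231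
(`free1342_append_cons`). Hence `L` is a decreasing sequence of blocks, one for each value gap of
`R`. Each block is an arbitrary, possibly empty, 1342-avoiding word, but only the highest gaps of `R`
may be used, those above which `R` avoids 231. Let `k` be their number, the number of free gaps of
`R`. The number of free gaps of `L ++ M :: R` can again be read off: if the highest nonempty block
lies below exactly `t` entries of `R` and has `j` free gaps, it is `1 + t + j`, and it is `1 + k` if
`L` is empty (`freeGaps_append_cons`, `fillingWeight_append`).

Let `F(x, v)` be the generating function in which `v` marks free gaps, so that `H(x) = F(x, 1)`. The
fillings of `k` gaps have the generating function `T k` with `T 0 = 1` and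
`T (k + 1) = v T k + (F - v) H ^ k`, according to whether the top gap is empty
(`fillingSum_eq_coeff`), and `F = v + x v Φ(T)`, where `Φ(T)` is the sum of `x ^ |R| T k` over all `R`
(`gapSeries_eq_add_sumOverGaps`). Since `(v - H) T k = v ^ k (F - H) - H ^ k (F - v)`, this becomes
`x v F² + H (1 - v - x v) F - v H (1 - v) = 0` (`gapSeries_quadratic`). Together with `H = F(x, 1)`
this equation determines `F` coefficient by coefficient (`eq_of_quadratic`). With
`t = (3 + √(1 - 8 x)) / 4`, so that `x = (1 - t) (2 t - 1)`, and with the Catalan series `c` of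
`v t (1 - t)`, the solution is `F = (1 + (v t - 1) c) / t²`, and `H = (2 t - 1) / t³`
(`quadratic_solution`, `setOne_gapSeries`).
-/

/-! ### Words avoiding 231 and 1342 -/

/-- The word `l` contains no pattern 231. -/
def Free231 (l : List ℕ) : Prop :=
  ∀ b c d, [b, c, d].Sublist l → d < b → ¬ b < c

/-- The word `l` contains no pattern 1342. -/
def Free1342 (l : List ℕ) : Prop :=
  ∀ a b c d, [a, b, c, d].Sublist l → a < d → d < b → ¬ b < c

/-- The part of the word `l` that consists of the entries that are at least `a`. -/
def upperPart (a : ℕ) (l : List ℕ) : List ℕ := l.filter (a ≤ ·)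

lemma mem_upperPart {a x : ℕ} {l : List ℕ} : x ∈ upperPart a l ↔ x ∈ l ∧ a ≤ x := by
  simp [upperPart]

lemma upperPart_sublist (a : ℕ) (l : List ℕ) : (upperPart a l).Sublist l :=
  List.filter_sublist

lemma upperPart_append (a : ℕ) (l₁ l₂ : List ℕ) :
    upperPart a (l₁ ++ l₂) = upperPart a l₁ ++ upperPart a l₂ := by
  simp [upperPart]

lemma upperPart_eq_nil {a : ℕ} {l : List ℕ} (h : ∀ x ∈ l, x < a) : upperPart a l = [] := by
  simpa [upperPart] using h

lemma upperPart_eq_self {a : ℕ} {l : List ℕ} (h : ∀ x ∈ l, a ≤ x) : upperPart a l = l := by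
  simpa [upperPart] using h

lemma sublist_upperPart_iff {a : ℕ} {s l : List ℕ} :
    s.Sublist (upperPart a l) ↔ s.Sublist l ∧ ∀ x ∈ s, a ≤ x := by
  refine ⟨fun h => ⟨h.trans (upperPart_sublist a l), fun x hx => ?_⟩, fun ⟨h, h'⟩ => ?_⟩
  · exact (mem_upperPart.1 (h.subset hx)).2
  · rw [← upperPart_eq_self h']
    exact h.filter _

lemma Free231.sublist {l l' : List ℕ} (h : Free231 l) (hl : l'.Sublist l) : Free231 l' :=
  fun b c d hs => h b c d (hs.trans hl)

lemma Free1342.sublist {l l' : List ℕ} (h : Free1342 l) (hl : l'.Sublist l) : Free1342 l' :=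
  fun a b c d hs => h a b c d (hs.trans hl)

lemma free231_nil : Free231 [] := by
  intro b c d h; simp at h

lemma free1342_nil : Free1342 [] := by
  intro a b c d h; simp at h

/-- An entry exceeding all others can only play the role of `3` in a pattern 231. -/
lemma free231_append_cons {L R : List ℕ} {M : ℕ} (hL : ∀ x ∈ L, x < M) (hR : ∀ x ∈ R, x < M) :
    Free231 (L ++ M :: R) ↔ Free231 L ∧ Free231 R ∧ ∀ x ∈ L, ∀ y ∈ R, ¬ y < x := by
  constructor
  · intro h
    refine ⟨h.sublist (List.sublist_append_left _ _), h.sublist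
      ((List.sublist_cons_self _ _).trans (List.sublist_append_right _ _)), fun x hx y hy hyx => ?_⟩
    refine h x M y ?_ hyx (hL x hx)
    exact List.Sublist.append (List.singleton_sublist.2 hx)
      ((List.singleton_sublist.2 hy).cons_cons M)
  · rintro ⟨h1, h2, h3⟩ b c d hs hdb hbc
    obtain ⟨s, t, he, hs, ht⟩ := List.sublist_append_iff.1 hs
    rcases s with _ | ⟨b', _ | ⟨c', _ | ⟨d', s⟩⟩⟩
    · simp only [List.nil_append] at he
      subst he
      rcases List.sublist_cons_iff.1 ht with ht | ⟨r, hr, ht⟩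
      · exact h2 b c d ht hdb hbc
      · simp only [List.cons.injEq] at hr
        obtain ⟨rfl, rfl⟩ := hr
        have := hR c (ht.subset (by simp))
        omega
    · simp only [List.cons_append, List.nil_append, List.cons.injEq] at he
      obtain ⟨rfl, rfl⟩ := he
      have hb : b ∈ L := hs.subset (by simp)
      have hd : d ∈ R := by
        rcases List.sublist_cons_iff.1 ht with ht | ⟨r, hr, ht⟩
        · exact ht.subset (by simp)
        · simp only [List.cons.injEq] at hr
          obtain ⟨rfl, rfl⟩ := hr
          exact ht.subset (by simp)
      exact h3 b hb d hd hdb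
    · simp only [List.cons_append, List.nil_append, List.cons.injEq] at he
      obtain ⟨rfl, rfl, rfl⟩ := he
      have hb : b ∈ L := hs.subset (by simp)
      have hd : d ∈ M :: R := ht.subset (by simp)
      rcases List.mem_cons.1 hd with rfl | hd
      · have := hL b hb
        omega
      · exact h3 b hb d hd hdb
    · simp only [List.cons_append, List.cons.injEq, List.nil_eq, List.append_eq_nil_iff] at he
      obtain ⟨rfl, rfl, rfl, rfl, rfl⟩ := he
      exact h1 b c d hs hdb hbc

/-- When the maximum `M` of a word `L ++ M :: R` plays a part in a pattern 1342, it plays the `4`;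
the third condition covers all patterns of which at least two entries lie in `L`, the last one
those of which exactly the first entry lies in `L`. -/
lemma free1342_append_cons {L R : List ℕ} {M : ℕ} (hL : ∀ x ∈ L, x < M) (hR : ∀ x ∈ R, x < M) :
    Free1342 (L ++ M :: R) ↔ Free1342 L ∧ Free1342 R ∧
      (∀ a b d, [a, b].Sublist L → d ∈ R → a < d → ¬ d < b) ∧
      ∀ a ∈ L, Free231 (upperPart (a + 1) R) := by
  constructor
  · intro h
    have hMR : R.Sublist (M :: R) := List.sublist_cons_self _ _
    refine ⟨h.sublist (List.sublist_append_left _ _), h.sublist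
      (hMR.trans (List.sublist_append_right _ _)),
      fun a b d hab hd had hdb => ?_, fun a ha b c d hbcd hdb hbc => ?_⟩
    · refine h a b M d ?_ had hdb (hL b (hab.subset (by simp)))
      exact hab.append ((List.singleton_sublist.2 hd).cons_cons M)
    · obtain ⟨h1, h2⟩ := sublist_upperPart_iff.1 hbcd
      refine h a b c d ?_ (h2 d (by simp)) hdb hbc
      exact (List.singleton_sublist.2 ha).append (h1.trans hMR)
  · rintro ⟨h1, h2, h3, h4⟩ a b c d hst had hdb hbc
    obtain ⟨s, t, he, hs, ht⟩ := List.sublist_append_iff.1 hst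
    rcases s with _ | ⟨a', _ | ⟨b', _ | ⟨c', _ | ⟨d', s⟩⟩⟩⟩
    · simp only [List.nil_append] at he
      subst he
      rcases List.sublist_cons_iff.1 ht with ht | ⟨r, hr, ht⟩
      · exact h2 a b c d ht had hdb hbc
      · simp only [List.cons.injEq] at hr
        obtain ⟨rfl, rfl⟩ := hr
        have := hR d (ht.subset (by simp))
        omega
    · simp only [List.cons_append, List.nil_append, List.cons.injEq] at he
      obtain ⟨rfl, rfl⟩ := he
      have ha : a ∈ L := hs.subset (by simp)
      rcases List.sublist_cons_iff.1 ht with ht | ⟨r, hr, ht⟩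
      · refine h4 a ha b c d (sublist_upperPart_iff.2 ⟨ht, ?_⟩) hdb hbc
        simp only [List.mem_cons, List.not_mem_nil, or_false, forall_eq_or_imp, forall_eq]
        omega
      · simp only [List.cons.injEq] at hr
        obtain ⟨rfl, rfl⟩ := hr
        have := hR c (ht.subset (by simp))
        omega
    · simp only [List.cons_append, List.nil_append, List.cons.injEq] at he
      obtain ⟨rfl, rfl, rfl⟩ := he
      have hd : d ∈ R := by
        rcases List.sublist_cons_iff.1 ht with ht | ⟨r, hr, ht⟩
        · exact ht.subset (by simp)
        · simp only [List.cons.injEq] at hr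
          obtain ⟨rfl, rfl⟩ := hr
          exact ht.subset (by simp)
      exact h3 a b d hs hd had hdb
    · simp only [List.cons_append, List.nil_append, List.cons.injEq] at he
      obtain ⟨rfl, rfl, rfl, rfl⟩ := he
      have hd : d ∈ M :: R := ht.subset (by simp)
      rcases List.mem_cons.1 hd with rfl | hd
      · have := hL b (hs.subset (by simp))
        omega
      · refine h3 a b d (List.Sublist.trans ?_ hs) hd had hdb
        exact ((List.nil_sublist [c]).cons_cons b).cons_cons a
    · simp only [List.cons_append, List.cons.injEq, List.nil_eq, List.append_eq_nil_iff] at he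
      obtain ⟨rfl, rfl, rfl, rfl, rfl, rfl⟩ := he
      exact h1 a b c d hs had hdb hbc

/-- The pattern 1342 is not a skew sum, so that it cannot straddle two blocks of which the first
lies above the second. -/
lemma Free1342.append {L L' : List ℕ} (h : Free1342 L) (h' : Free1342 L')
    (hlt : ∀ x ∈ L, ∀ y ∈ L', y < x) : Free1342 (L ++ L') := by
  intro a b c d hs had hdb hbc
  obtain ⟨s, t, he, hs, ht⟩ := List.sublist_append_iff.1 hs
  rcases s with _ | ⟨a', s⟩
  · simp only [List.nil_append] at he
    subst he
    exact h' a b c d ht had hdb hbc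
  · have ha : a ∈ L := by
      simp only [List.cons_append, List.cons.injEq] at he
      exact he.1 ▸ hs.subset (by simp)
    rcases List.eq_nil_or_concat' t with rfl | ⟨t, x, rfl⟩
    · rw [List.append_nil] at he
      exact h a b c d (he ▸ hs) had hdb hbc
    · have hx : d = x := by
        have := congrArg List.getLast? (he.trans (List.append_assoc (a' :: s) t [x]).symm)
        simpa only [List.getLast?_concat, List.getLast?_cons_cons, List.getLast?_singleton,
          Option.some.injEq] using this
      have := hlt a ha d (ht.subset (by simp [hx]))
      omega

/-- The words in which every element of the finite set `A` occurs exactly once. -/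
def words (A : Finset ℕ) : Finset (List ℕ) := ⟨A.val.lists, Multiset.lists_nodup_finset A⟩

lemma mem_words {A : Finset ℕ} {l : List ℕ} :
    l ∈ words A ↔ l.Nodup ∧ ∀ x, x ∈ l ↔ x ∈ A := by
  have h : l ∈ words A ↔ A.val = (l : Multiset ℕ) := Multiset.mem_lists_iff _ _
  rw [h]
  constructor
  · intro h
    refine ⟨Multiset.coe_nodup.1 (h ▸ A.nodup), fun x => ?_⟩
    rw [← Finset.mem_val, h, Multiset.mem_coe]
  · rintro ⟨h1, h2⟩
    exact (Multiset.Nodup.ext A.nodup (Multiset.coe_nodup.2 h1)).2 (by simpa using fun x => (h2 x).symm)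

open Classical in
/-- The 1342-avoiding arrangements of the finite set `A`. -/
noncomputable def avoiders (A : Finset ℕ) : Finset (List ℕ) := (words A).filter Free1342

lemma mem_avoiders {A : Finset ℕ} {l : List ℕ} :
    l ∈ avoiders A ↔ (l.Nodup ∧ ∀ x, x ∈ l ↔ x ∈ A) ∧ Free1342 l := by
  simp [avoiders, mem_words]

lemma avoiders_empty : avoiders ∅ = {[]} := by
  ext l
  rw [mem_avoiders, mem_singleton]
  constructor
  · rintro ⟨⟨-, h⟩, -⟩
    exact List.eq_nil_iff_forall_not_mem.2 (by simpa using h)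
  · rintro rfl
    exact ⟨by simp, free1342_nil⟩

open Classical in
/-- The entries `a` of `l` for which the entries of `l` that are at least `a` avoid 231. -/
noncomputable def freeEntries (l : List ℕ) : Finset ℕ :=
  l.toFinset.filter fun a => Free231 (upperPart a l)

/-- The number of value gaps of the word `l` above which `l` avoids 231. A 1342-avoiding word `l`
with a new maximum in front of it can be preceded by entries in exactly these gaps. -/
noncomputable def freeGaps (l : List ℕ) : ℕ := #(freeEntries l) + 1

lemma mem_freeEntries {l : List ℕ} {a : ℕ} :
    a ∈ freeEntries l ↔ a ∈ l ∧ Free231 (upperPart a l) := by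
  simp [freeEntries]

lemma upperPart_sublist_upperPart {a b : ℕ} (h : a ≤ b) (l : List ℕ) :
    (upperPart b l).Sublist (upperPart a l) :=
  sublist_upperPart_iff.2 ⟨upperPart_sublist _ _, fun _ hx => h.trans (mem_upperPart.1 hx).2⟩

/-- Whether the entries `≥ a` avoid 231 can be read off from their number. -/
lemma free231_upperPart_iff {A : Finset ℕ} {l : List ℕ} (hl : ∀ x, x ∈ l ↔ x ∈ A) (a : ℕ) :
    Free231 (upperPart a l) ↔ #{x ∈ A | a ≤ x} < freeGaps l := by
  rw [freeGaps, Nat.lt_succ_iff]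
  constructor
  · refine fun h => card_le_card fun x hx => ?_
    simp only [mem_filter] at hx
    exact mem_freeEntries.2 ⟨(hl x).2 hx.1, h.sublist (upperPart_sublist_upperPart hx.2 l)⟩
  · intro h
    by_contra hn
    obtain ⟨b, c, d, hs, hdb, hbc⟩ : ∃ b c d, [b, c, d].Sublist (upperPart a l) ∧ d < b ∧ b < c := by
      simpa [Free231] using hn
    obtain ⟨hs1, hs2⟩ := sublist_upperPart_iff.1 hs
    refine absurd h (not_le.2 (card_lt_card ⟨fun x hx => ?_, fun hsub => ?_⟩))
    · obtain ⟨hxl, hx⟩ := mem_freeEntries.1 hx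
      simp only [mem_filter]
      refine ⟨(hl x).1 hxl, ?_⟩
      by_contra! hxa
      exact hn (hx.sublist (upperPart_sublist_upperPart hxa.le l))
    · have hd : d ∈ freeEntries l :=
        hsub (mem_filter.2 ⟨(hl d).1 (hs1.subset (by simp)), hs2 d (by simp)⟩)
      refine (mem_freeEntries.1 hd).2 b c d (sublist_upperPart_iff.2 ⟨hs1, ?_⟩) hdb hbc
      simp only [List.mem_cons, List.not_mem_nil, or_false, forall_eq_or_imp, forall_eq]
      omega

lemma freeGaps_le {A : Finset ℕ} {l : List ℕ} (hl : ∀ x, x ∈ l ↔ x ∈ A) :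
    freeGaps l ≤ #A + 1 :=
  Nat.succ_le_succ (card_le_card fun _ hx => (hl _).1 (mem_freeEntries.1 hx).1)

/-! ### Decomposition of a 1342-avoiding word at its maximum -/

/-- The word `L` may be placed to the left of a new maximum that is followed by a word on `B` with
`k` free gaps: `L` avoids 1342, it splits into blocks decreasing along the value gaps of `B`, and it
uses only the `k` highest of these gaps. -/
def FitsGaps (B : Finset ℕ) (k : ℕ) (L : List ℕ) : Prop :=
  Free1342 L ∧ (∀ a b d, [a, b].Sublist L → d ∈ B → a < d → ¬ d < b) ∧
    ∀ a ∈ L, #{x ∈ B | a < x} < k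

open Classical in
/-- The words on `A \ B` that fit the `k` highest value gaps of `B`. -/
noncomputable def gapFillings (A B : Finset ℕ) (k : ℕ) : Finset (List ℕ) :=
  (words (A \ B)).filter (FitsGaps B k)

lemma mem_gapFillings {A B : Finset ℕ} {k : ℕ} {L : List ℕ} :
    L ∈ gapFillings A B k ↔ (L.Nodup ∧ ∀ x, x ∈ L ↔ x ∈ A ∧ x ∉ B) ∧ FitsGaps B k L := by
  simp [gapFillings, mem_words]

/-- The elements `a` of `A` such that the entries `≥ a` avoid 231 in every word `L ++ M :: R` where
`M` is a new maximum and `R` is a word on `B` with `k` free gaps. -/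
def JointlyFree (B : Finset ℕ) (k : ℕ) (L : List ℕ) (a : ℕ) : Prop :=
  Free231 (upperPart a L) ∧ #{x ∈ B | a ≤ x} < k ∧ ∀ x ∈ L, ∀ y ∈ B, a ≤ y → ¬ y < x

open Classical in
/-- One less than the number of free gaps of `L ++ M :: R`, where `M` is a new maximum and `R` a
word on `B` with `k` free gaps. The value at `k = 0`, which does not occur for a word `R`, is chosen
such that `fillingWeight_append` holds for `k = 0` as well. -/
noncomputable def fillingWeight (A B : Finset ℕ) (k : ℕ) (L : List ℕ) : ℕ :=
  #(A.filter (JointlyFree B k L)) + if k = 0 then 0 else 1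

lemma append_cons_mem_avoiders_iff {A B : Finset ℕ} {M : ℕ} (hA : ∀ x ∈ A, x < M) (hB : B ⊆ A)
    {L R : List ℕ} (hL : L.Nodup ∧ ∀ x, x ∈ L ↔ x ∈ A ∧ x ∉ B)
    (hR : R.Nodup ∧ ∀ x, x ∈ R ↔ x ∈ B) :
    L ++ M :: R ∈ avoiders (insert M A) ↔ R ∈ avoiders B ∧ L ∈ gapFillings A B (freeGaps R) := by
  have hLM : ∀ x ∈ L, x < M := fun x hx => hA x ((hL.2 x).1 hx).1
  have hRM : ∀ x ∈ R, x < M := fun x hx => hA x (hB ((hR.2 x).1 hx))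
  have hw : (L ++ M :: R).Nodup ∧ ∀ x, x ∈ L ++ M :: R ↔ x ∈ insert M A := by
    refine ⟨?_, fun x => ?_⟩
    · rw [List.nodup_append', List.nodup_cons]
      refine ⟨hL.1, ⟨fun h => (hRM M h).false, hR.1⟩, fun x hx hx' => ?_⟩
      rcases List.mem_cons.1 hx' with rfl | hx'
      · exact (hLM x hx).false
      · exact ((hL.2 x).1 hx).2 ((hR.2 x).1 hx')
    · simp only [List.mem_append, List.mem_cons, hL.2, hR.2, mem_insert]
      have := @hB x
      tauto
  rw [mem_avoiders, mem_avoiders, mem_gapFillings, free1342_append_cons hLM hRM, FitsGaps]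
  simp only [hw, hL, hR, free231_upperPart_iff hR.2, Nat.succ_le_iff, true_and, implies_true]
  tauto

lemma freeGaps_append_cons {A B : Finset ℕ} {M : ℕ} (hA : ∀ x ∈ A, x < M) (hB : B ⊆ A)
    {L R : List ℕ} (hL : ∀ x, x ∈ L ↔ x ∈ A ∧ x ∉ B) (hR : ∀ x, x ∈ R ↔ x ∈ B) :
    freeGaps (L ++ M :: R) = fillingWeight A B (freeGaps R) L + 1 := by
  classical
  have hLM : ∀ x ∈ L, x < M := fun x hx => hA x ((hL x).1 hx).1
  have hRM : ∀ x ∈ R, x < M := fun x hx => hA x (hB ((hR x).1 hx))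
  have hup : ∀ a, a ≤ M → upperPart a (L ++ M :: R) = upperPart a L ++ M :: upperPart a R := by
    intro a ha
    simp [upperPart, ha]
  have key : ∀ a, a ≤ M → (Free231 (upperPart a (L ++ M :: R)) ↔
      JointlyFree B (freeGaps R) L a) := by
    intro a ha
    rw [hup a ha, free231_append_cons (fun x hx => hLM x (mem_upperPart.1 hx).1)
      (fun x hx => hRM x (mem_upperPart.1 hx).1), free231_upperPart_iff hR, JointlyFree]
    refine and_congr_right fun _ => and_congr_right fun _ => ?_
    simp only [mem_upperPart, hR]
    constructor
    · intro h x hx y hy hay hyx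
      exact h x ⟨hx, by omega⟩ y ⟨hy, hay⟩ hyx
    · rintro h x ⟨hx, -⟩ y ⟨hy, hay⟩
      exact h x hx y hy hay
  have hM : JointlyFree B (freeGaps R) L M := by
    refine (key M le_rfl).1 ?_
    rw [hup M le_rfl, upperPart_eq_nil hLM, upperPart_eq_nil hRM]
    intro b c d h
    have := h.length_le
    simp at this
  have h0 : freeGaps R ≠ 0 := Nat.succ_ne_zero _
  have hset : freeEntries (L ++ M :: R) = insert M (A.filter (JointlyFree B (freeGaps R) L)) := by
    ext a
    simp only [mem_freeEntries, mem_insert, mem_filter, List.mem_append, List.mem_cons, hL, hR]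
    constructor
    · rintro ⟨h1, h2⟩
      by_cases haM : a = M
      · exact Or.inl haM
      · have haA : a ∈ A := by
          have := @hB a
          tauto
        exact Or.inr ⟨haA, (key a (hA a haA).le).1 h2⟩
    · rintro (rfl | ⟨h1, h2⟩)
      · exact ⟨by tauto, (key a le_rfl).2 hM⟩
      · exact ⟨by tauto, (key a (hA a h1).le).2 h2⟩
  rw [freeGaps, hset, card_insert_of_notMem, fillingWeight, if_neg h0]
  exact fun h => (hA M (mem_filter.1 h).1).false

lemma card_filter_eq_card_filter_erase_add_one {B : Finset ℕ} {b : ℕ} (hb : b ∈ B) (p : ℕ → Prop)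
    [DecidablePred p] (hp : p b) : #(B.filter p) = #((B.erase b).filter p) + 1 := by
  rw [filter_erase, card_erase_add_one]
  exact mem_filter.2 ⟨hb, hp⟩

/-- The top gap of `B`, above its maximum `b`, holds an arbitrary 1342-avoiding word; what is left
fills gaps of the rest of `B`. -/
lemma append_mem_gapFillings_iff {A B : Finset ℕ} {b k : ℕ} (hb : b ∈ B) (hB : ∀ x ∈ B, x ≤ b)
    {L₁ L₂ : List ℕ}
    (h₁ : L₁.Nodup ∧ ∀ x, x ∈ L₁ ↔ x ∈ A.filter (b < ·))
    (h₂ : L₂.Nodup ∧ ∀ x, x ∈ L₂ ↔ x ∈ A.filter (· < b) ∧ x ∉ B.erase b) :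
    L₁ ++ L₂ ∈ gapFillings A B (k + 1) ↔
      L₁ ∈ avoiders (A.filter (b < ·)) ∧ L₂ ∈ gapFillings (A.filter (· < b)) (B.erase b) k := by
  have hgt : ∀ x ∈ L₁, b < x := fun x hx => (mem_filter.1 ((h₁.2 x).1 hx)).2
  have hlt : ∀ x ∈ L₂, x < b := fun x hx => (mem_filter.1 ((h₂.2 x).1 hx).1).2
  have hw : (L₁ ++ L₂).Nodup ∧ ∀ x, x ∈ L₁ ++ L₂ ↔ x ∈ A ∧ x ∉ B := by
    refine ⟨?_, fun x => ?_⟩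
    · rw [List.nodup_append']
      exact ⟨h₁.1, h₂.1, fun x hx hx' => ((hgt x hx).trans (hlt x hx')).false⟩
    · simp only [List.mem_append, h₁.2, h₂.2, mem_filter, mem_erase]
      rcases lt_trichotomy x b with h | rfl | h
      · have := h.ne
        have := h.le.not_gt
        tauto
      · simp [hb]
      · have : x ∉ B := fun hx => (hB x hx).not_gt h
        have := h.le.not_gt
        tauto
  rw [mem_gapFillings, mem_gapFillings, mem_avoiders, and_iff_right hw, and_iff_right h₁,
    and_iff_right h₂]
  constructor
  · rintro ⟨h1, h2, h3⟩
    refine ⟨h1.sublist (List.sublist_append_left _ _), h1.sublist (List.sublist_append_right _ _),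
      fun a c d hs hd => h2 a c d (hs.trans (List.sublist_append_right _ _)) (erase_subset _ _ hd),
      fun a ha => ?_⟩
    have := h3 a (by simp [ha])
    rw [card_filter_eq_card_filter_erase_add_one hb (fun x => a < x) (hlt a ha)] at this
    omega
  · rintro ⟨h1, h2, h3, h4⟩
    refine ⟨h1.append h2 fun x hx y hy => (hlt y hy).trans (hgt x hx), ?_, ?_⟩
    · intro a c d hs hd had hdc
      obtain ⟨s, t, he, hs, ht⟩ := List.sublist_append_iff.1 hs
      have hdb := hB d hd
      have haL : a ∈ L₂ := by
        have : a ∈ L₁ ++ L₂ := by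
          rw [List.mem_append]
          have : a ∈ s ++ t := by simp [← he]
          exact (List.mem_append.1 this).imp (fun h => hs.subset h) (fun h => ht.subset h)
        rcases List.mem_append.1 this with h | h
        · have := hgt a h
          omega
        · exact h
      rcases s with _ | ⟨a', s⟩
      · simp only [List.nil_append] at he
        subst he
        have := hlt c (ht.subset (by simp))
        exact h3 a c d ht (mem_erase.2 ⟨by omega, hd⟩) had hdc
      · simp only [List.cons_append, List.cons.injEq] at he
        have := hgt a (hs.subset (by simp [he.1]))
        omega
    · intro a ha
      rcases List.mem_append.1 ha with h | h
      · have : #{x ∈ B | a < x} = 0 := by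
          rw [card_eq_zero, filter_eq_empty_iff]
          intro x hx
          have := hB x hx
          have := hgt a h
          omega
        omega
      · rw [card_filter_eq_card_filter_erase_add_one hb (fun x => a < x) (hlt a h)]
        have := h4 a h
        omega

lemma filter_append_filter_of_pair_condition {b : ℕ} {L : List ℕ} (hb : b ∉ L)
    (h : ∀ a c, [a, c].Sublist L → a < b → ¬ b < c) :
    L.filter (b < ·) ++ L.filter (· < b) = L := by
  induction L with
  | nil => rfl
  | cons y L ih =>
    simp only [List.mem_cons, not_or] at hb
    have ih' := ih hb.2 fun a c hs => h a c (hs.trans (List.sublist_cons_self _ _))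
    rcases lt_or_gt_of_ne hb.1 with hy | hy
    · have : ¬ y < b := by omega
      simp [hy, this, ih']
    · have hlt : ∀ x ∈ L, x < b := by
        intro x hx
        have := h y x ((List.singleton_sublist.2 hx).cons_cons y) hy
        have : x ≠ b := fun hxb => hb.2 (hxb ▸ hx)
        omega
      have e1 : L.filter (b < ·) = [] := by
        simpa using fun x hx => (hlt x hx).le
      have e2 : L.filter (· < b) = L := by simpa using hlt
      have : ¬ b < y := by omega
      simp [hy, this, e1, e2]

/-- If the top gap of `B` holds a nonempty word, then all free gaps are gaps of this word;
otherwise there is one free gap above the maximum of `B`. -/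
lemma fillingWeight_append {A B : Finset ℕ} {b k : ℕ} (hBA : B ⊆ A) (hb : b ∈ B)
    (hB : ∀ x ∈ B, x ≤ b)
    {L₁ L₂ : List ℕ} (h₁ : ∀ x, x ∈ L₁ ↔ x ∈ A.filter (b < ·))
    (h₂ : ∀ x, x ∈ L₂ ↔ x ∈ A.filter (· < b) ∧ x ∉ B.erase b) :
    fillingWeight A B (k + 1) (L₁ ++ L₂) = if A.filter (b < ·) = ∅ then
      fillingWeight (A.filter (· < b)) (B.erase b) k L₂ + 1 else freeGaps L₁ := by
  classical
  have hgt : ∀ x ∈ L₁, b < x := fun x hx => (mem_filter.1 ((h₁ x).1 hx)).2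
  have hlt : ∀ x ∈ L₂, x < b := fun x hx => (mem_filter.1 ((h₂ x).1 hx).1).2
  rw [fillingWeight, if_neg (Nat.succ_ne_zero k)]
  split_ifs with hE
  · have hnil : L₁ = [] := List.eq_nil_iff_forall_not_mem.2 fun x hx => by
      have := (h₁ x).1 hx
      simp [hE] at this
    subst hnil
    rw [List.nil_append, add_left_inj, fillingWeight]
    have hA : A = insert b (A.filter (· < b)) := by
      ext x
      simp only [mem_insert, mem_filter]
      constructor
      · intro hx
        have : ¬ b < x := fun h => by
          have : x ∈ A.filter (b < ·) := mem_filter.2 ⟨hx, h⟩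
          simp [hE] at this
        by_cases hxb : x = b
        · exact Or.inl hxb
        · exact Or.inr ⟨hx, by omega⟩
      · rintro (rfl | h)
        · exact hBA hb
        · exact h.1
    have hcongr : ∀ a ∈ A.filter (· < b), JointlyFree B (k + 1) L₂ a ↔
        JointlyFree (B.erase b) k L₂ a := by
      intro a ha
      have hab := (mem_filter.1 ha).2
      rw [JointlyFree, JointlyFree, card_filter_eq_card_filter_erase_add_one hb _ hab.le,
        Nat.add_lt_add_iff_right]
      refine and_congr_right fun _ => and_congr_right fun _ => ?_
      refine forall₂_congr fun x hx => ⟨fun h y hy => h y (erase_subset _ _ hy), fun h y hy hay => ?_⟩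
      by_cases hyb : y = b
      · have := hlt x hx
        omega
      · exact h y (mem_erase.2 ⟨hyb, hy⟩) hay
    have hbfree : JointlyFree B (k + 1) L₂ b ↔ k ≠ 0 := by
      rw [JointlyFree, upperPart_eq_nil hlt,
        card_filter_eq_card_filter_erase_add_one hb _ le_rfl, Nat.add_lt_add_iff_right]
      have : #((B.erase b).filter (b ≤ ·)) = 0 := by
        rw [card_eq_zero, filter_eq_empty_iff]
        intro x hx
        have := hB x (erase_subset _ _ hx)
        have := (mem_erase.1 hx).1
        omega
      rw [this]
      constructor
      · rintro ⟨-, h, -⟩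
        omega
      · intro h
        refine ⟨free231_nil, by omega, fun x hx y hy hby => ?_⟩
        have := hlt x hx
        omega
    rw [hA, filter_insert, ← hA, ← filter_congr hcongr]
    by_cases hk : k = 0
    · rw [if_neg fun h => hbfree.1 h hk, if_pos hk]
      simp
    · rw [if_pos (hbfree.2 hk), if_neg hk, card_insert_of_notMem (by simp)]
  · rw [freeGaps, add_left_inj]
    congr 1
    obtain ⟨x₀, hx₀⟩ := nonempty_iff_ne_empty.2 hE
    have hx₀' := (h₁ x₀).2 hx₀
    ext a
    rw [mem_filter, mem_freeEntries, h₁, JointlyFree, upperPart_append]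
    constructor
    · rintro ⟨haA, h1, h2, h3⟩
      have hba : b < a := by
        by_contra! hab
        exact h3 x₀ (by simp [hx₀']) b hb hab (hgt x₀ hx₀')
      exact ⟨mem_filter.2 ⟨haA, hba⟩, h1.sublist (List.sublist_append_left _ _)⟩
    · rintro ⟨haA, h1⟩
      obtain ⟨haA, hba⟩ := mem_filter.1 haA
      refine ⟨haA, ?_, ?_, ?_⟩
      · rwa [upperPart_eq_nil (l := L₂) fun x hx => (hlt x hx).trans hba, List.append_nil]
      · have : #{x ∈ B | a ≤ x} = 0 := by
          rw [card_eq_zero, filter_eq_empty_iff]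
          intro x hx
          have := hB x hx
          omega
        omega
      · intro x hx y hy hay
        have := hB y hy
        omega

/-! ### Generating polynomials -/

open Polynomial in
/-- The generating polynomial of the 1342-avoiding arrangements of `A` by their number of free
gaps. -/
noncomputable def gapPoly (A : Finset ℕ) : ℂ[X] := ∑ l ∈ avoiders A, X ^ freeGaps l

open Polynomial in
/-- The generating polynomial of the fillings of the `k` highest gaps of `B` with `A \ B`. -/
noncomputable def fillingPoly (A B : Finset ℕ) (k : ℕ) : ℂ[X] :=
  ∑ L ∈ gapFillings A B k, X ^ fillingWeight A B k L

/-- The sum of `fillingPoly A B k` over all `m`-element subsets `B` of `A`. -/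
noncomputable def fillingSum (A : Finset ℕ) (m k : ℕ) : ℂ[X] :=
  ∑ B ∈ A.powersetCard m, fillingPoly A B k

open Classical in
lemma fillingPoly_zero {A B : Finset ℕ} (hB : B ⊆ A) :
    fillingPoly A B 0 = if B = A then 1 else 0 := by
  have hnil : ∀ L ∈ gapFillings A B 0, L = [] := fun L hL =>
    List.eq_nil_iff_forall_not_mem.2 fun x hx =>
      absurd ((mem_gapFillings.1 hL).2.2.2 x hx) (Nat.not_lt_zero _)
  split_ifs with h
  · subst h
    have : gapFillings B B 0 = {[]} := by
      ext L
      rw [mem_singleton]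
      refine ⟨hnil L, ?_⟩
      rintro rfl
      exact mem_gapFillings.2 ⟨⟨List.nodup_nil, by simp⟩, free1342_nil, by simp, by simp⟩
    rw [fillingPoly, this, sum_singleton, fillingWeight]
    have h0 : ∀ x ∈ B, ¬ JointlyFree B 0 [] x := fun x _ h => Nat.not_lt_zero _ h.2.1
    rw [card_eq_zero.2 (filter_eq_empty_iff.2 h0)]
    simp
  · refine sum_eq_zero fun L hL => absurd ?_ h
    have hL' := hnil L hL
    subst hL'
    refine hB.antisymm fun x hx => ?_
    by_contra hxB
    simpa using ((mem_gapFillings.1 hL).1.2 x).2 ⟨hx, hxB⟩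

lemma fillingPoly_empty_one (A : Finset ℕ) : fillingPoly A ∅ 1 = gapPoly A := by
  have : gapFillings A ∅ 1 = avoiders A := by
    ext L
    simp [mem_gapFillings, mem_avoiders, FitsGaps]
  rw [fillingPoly, gapPoly, this]
  refine sum_congr rfl fun L hL => ?_
  rw [fillingWeight, freeGaps, if_neg one_ne_zero]
  congr 3
  ext a
  have := (mem_avoiders.1 hL).1.2 a
  simp [mem_freeEntries, JointlyFree, this]

lemma length_of_mem_words {A : Finset ℕ} {l : List ℕ} (h : l.Nodup ∧ ∀ x, x ∈ l ↔ x ∈ A) :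
    l.length = #A := by
  rw [← List.toFinset_card_of_nodup h.1]
  congr 1
  ext x
  simp [h.2]

open Polynomial in
lemma fillingPoly_succ {A B : Finset ℕ} {b : ℕ} (hBA : B ⊆ A) (hb : b ∈ B) (hB : ∀ x ∈ B, x ≤ b)
    (k : ℕ) :
    fillingPoly A B (k + 1) = if A.filter (b < ·) = ∅ then
      X * fillingPoly (A.filter (· < b)) (B.erase b) k
      else gapPoly (A.filter (b < ·)) * C (eval 1 (fillingPoly (A.filter (· < b)) (B.erase b) k)) := by
  have hprod : fillingPoly A B (k + 1) =
      ∑ q ∈ avoiders (A.filter (b < ·)) ×ˢ gapFillings (A.filter (· < b)) (B.erase b) k,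
        X ^ fillingWeight A B (k + 1) (q.1 ++ q.2) := by
    symm
    rw [fillingPoly]
    refine sum_bij (fun q _ => q.1 ++ q.2) ?_ ?_ ?_ fun _ _ => rfl
    · rintro ⟨L₁, L₂⟩ hq
      obtain ⟨h1, h2⟩ := mem_product.1 hq
      exact (append_mem_gapFillings_iff hb hB (mem_avoiders.1 h1).1 (mem_gapFillings.1 h2).1).2
        ⟨h1, h2⟩
    · rintro ⟨L₁, L₂⟩ hq ⟨L₁', L₂'⟩ hq' he
      have h1 := length_of_mem_words (mem_avoiders.1 (mem_product.1 hq).1).1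
      have h1' := length_of_mem_words (mem_avoiders.1 (mem_product.1 hq').1).1
      obtain ⟨h, h'⟩ := List.append_inj he (h1.trans h1'.symm)
      exact Prod.ext h h'
    · intro L hL
      obtain ⟨⟨hnd, hmem⟩, hfit⟩ := mem_gapFillings.1 hL
      have hsplit := filter_append_filter_of_pair_condition (b := b) (L := L)
        (fun h => ((hmem b).1 h).2 hb) fun a c hs => hfit.2.1 a c b hs hb
      have h₁ : (L.filter (b < ·)).Nodup ∧ ∀ x, x ∈ L.filter (b < ·) ↔ x ∈ A.filter (b < ·) := by
        refine ⟨hnd.filter _, fun x => ?_⟩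
        simp only [List.mem_filter, decide_eq_true_eq, mem_filter, hmem]
        have : b < x → x ∉ B := fun h hx => (hB x hx).not_gt h
        tauto
      have h₂ : (L.filter (· < b)).Nodup ∧
          ∀ x, x ∈ L.filter (· < b) ↔ x ∈ A.filter (· < b) ∧ x ∉ B.erase b := by
        refine ⟨hnd.filter _, fun x => ?_⟩
        simp only [List.mem_filter, decide_eq_true_eq, mem_filter, hmem, mem_erase]
        have : x < b → x ≠ b := fun h => h.ne
        tauto
      refine ⟨(L.filter (b < ·), L.filter (· < b)), mem_product.2 ?_, hsplit⟩
      exact (append_mem_gapFillings_iff hb hB h₁ h₂).1 (hsplit.symm ▸ hL)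
  have hweight : ∀ q ∈ avoiders (A.filter (b < ·)) ×ˢ
      gapFillings (A.filter (· < b)) (B.erase b) k,
      fillingWeight A B (k + 1) (q.1 ++ q.2) = if A.filter (b < ·) = ∅ then
        fillingWeight (A.filter (· < b)) (B.erase b) k q.2 + 1 else freeGaps q.1 := by
    intro q hq
    obtain ⟨h1, h2⟩ := mem_product.1 hq
    exact fillingWeight_append hBA hb hB (mem_avoiders.1 h1).1.2 (mem_gapFillings.1 h2).1.2
  rw [hprod, sum_congr rfl fun q hq => by rw [hweight q hq]]
  split_ifs with hE
  · rw [hE, avoiders_empty, singleton_product, sum_map, fillingPoly, mul_sum]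
    exact sum_congr rfl fun L _ => pow_succ' _ _
  · rw [sum_product, gapPoly, sum_mul]
    refine sum_congr rfl fun l _ => ?_
    simp [fillingPoly, eval_finsetSum, mul_comm]

/-- A set of size `m + 1` is determined by its maximum `b` and a set of size `m` below `b`. -/
lemma sum_powersetCard_succ_eq_sum_max {M : Type*} [AddCommMonoid M] (A : Finset ℕ) (m : ℕ)
    (φ : ℕ → Finset ℕ → M) :
    ∑ b ∈ A, ∑ B ∈ (A.filter (· < b)).powersetCard m, φ b (insert b B) =
      ∑ B ∈ A.powersetCard (m + 1), φ (B.sup id) B := by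
  have hmax : ∀ b ∈ A, ∀ B ∈ (A.filter (· < b)).powersetCard m,
      b ∉ B ∧ (insert b B).sup id = b := by
    intro b _ B hB
    have hlt : ∀ x ∈ B, x < b := fun x hx => (mem_filter.1 ((mem_powersetCard.1 hB).1 hx)).2
    refine ⟨fun h => (hlt b h).false, ?_⟩
    rw [sup_insert, id, sup_eq_left]
    exact Finset.sup_le fun x hx => (hlt x hx).le
  rw [sum_sigma']
  refine sum_bij (fun q _ => insert q.1 q.2) ?_ ?_ ?_ ?_
  · rintro ⟨b, B⟩ hq
    obtain ⟨hb, hB⟩ := mem_sigma.1 hq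
    have hnm := (hmax b hb B hB).1
    obtain ⟨hBA, hcard⟩ := mem_powersetCard.1 hB
    exact mem_powersetCard.2 ⟨insert_subset hb (hBA.trans (filter_subset _ _)),
      by rw [card_insert_of_notMem hnm, hcard]⟩
  · rintro ⟨b, B⟩ hq ⟨b', B'⟩ hq' he
    obtain ⟨hb, hB⟩ := mem_sigma.1 hq
    obtain ⟨hb', hB'⟩ := mem_sigma.1 hq'
    obtain ⟨hn, hs⟩ := hmax b hb B hB
    obtain ⟨hn', hs'⟩ := hmax b' hb' B' hB'
    simp only at he hn hs hn' hs'
    have hbb : b = b' := by rw [← hs, ← hs', he]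
    subst hbb
    rw [← erase_insert hn, he, erase_insert hn']
  · intro B hB
    obtain ⟨hBA, hcard⟩ := mem_powersetCard.1 hB
    have hne : B.Nonempty := card_pos.1 (by omega)
    obtain ⟨b, hb, hbs⟩ := exists_mem_eq_sup B hne id
    have hle : ∀ x ∈ B, x ≤ b := fun x hx => (le_sup (f := id) hx).trans_eq hbs
    refine ⟨⟨b, B.erase b⟩, mem_sigma.2 ⟨hBA hb, mem_powersetCard.2 ⟨fun x hx => ?_, ?_⟩⟩,
      insert_erase hb⟩
    · obtain ⟨hxb, hx⟩ := mem_erase.1 hx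
      exact mem_filter.2 ⟨hBA hx, lt_of_le_of_ne (hle x hx) hxb⟩
    · rw [card_erase_of_mem hb, hcard, Nat.add_sub_cancel]
  · rintro ⟨b, B⟩ hq
    obtain ⟨hb, hB⟩ := mem_sigma.1 hq
    simp only
    rw [(hmax b hb B hB).2]

open Polynomial in
lemma fillingSum_succ (A : Finset ℕ) (m k : ℕ) :
    fillingSum A (m + 1) (k + 1) = ∑ b ∈ A, if A.filter (b < ·) = ∅ then
      X * fillingSum (A.filter (· < b)) m k
      else gapPoly (A.filter (b < ·)) * C (eval 1 (fillingSum (A.filter (· < b)) m k)) := by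
  rw [fillingSum, ← sum_powersetCard_succ_eq_sum_max A m fun _ B => fillingPoly A B (k + 1)]
  refine sum_congr rfl fun b hbA => ?_
  have key : ∀ B ∈ (A.filter (· < b)).powersetCard m, fillingPoly A (insert b B) (k + 1) =
      if A.filter (b < ·) = ∅ then X * fillingPoly (A.filter (· < b)) B k
      else gapPoly (A.filter (b < ·)) * C (eval 1 (fillingPoly (A.filter (· < b)) B k)) := by
    intro B hB
    obtain ⟨hBA, -⟩ := mem_powersetCard.1 hB
    have hlt : ∀ x ∈ B, x < b := fun x hx => (mem_filter.1 (hBA hx)).2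
    have hn : b ∉ B := fun h => (hlt b h).false
    rw [fillingPoly_succ (b := b) (insert_subset hbA (hBA.trans (filter_subset _ _)))
      (mem_insert_self _ _), erase_insert hn]
    intro x hx
    rcases mem_insert.1 hx with rfl | hx
    · exact le_rfl
    · exact (hlt x hx).le
  rw [sum_congr rfl key]
  split_ifs with hE
  · rw [fillingSum, mul_sum]
  · rw [fillingSum, eval_finsetSum, map_sum, mul_sum]

open Polynomial in
lemma coeff_gapPoly (A : Finset ℕ) (k : ℕ) :
    (gapPoly A).coeff k = #{l ∈ avoiders A | freeGaps l = k} := by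
  simp only [gapPoly, finsetSum_coeff, coeff_X_pow, card_filter, Nat.cast_sum, Nat.cast_ite,
    Nat.cast_one, Nat.cast_zero, eq_comm]

open Polynomial in
lemma natDegree_gapPoly_le (A : Finset ℕ) : (gapPoly A).natDegree ≤ #A + 1 :=
  natDegree_sum_le_of_forall_le _ _ fun l hl => by
    rw [natDegree_X_pow]
    exact freeGaps_le (mem_avoiders.1 hl).1.2

lemma sum_avoiders_freeGaps (A : Finset ℕ) (φ : ℕ → ℂ[X]) :
    ∑ l ∈ avoiders A, φ (freeGaps l) =
      ∑ k ∈ range (#A + 2), Polynomial.C ((gapPoly A).coeff k) * φ k := by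
  rw [← sum_fiberwise_of_maps_to (t := range (#A + 2)) (g := freeGaps)
    fun l hl => mem_range.2 (Nat.lt_succ_of_le (freeGaps_le (mem_avoiders.1 hl).1.2))]
  refine sum_congr rfl fun k _ => ?_
  rw [coeff_gapPoly, sum_congr rfl fun l hl => by rw [(mem_filter.1 hl).2], sum_const]
  simp

open Polynomial in
/-- Decomposition of 1342-avoiding words at their maximum `M`. -/
lemma gapPoly_insert {A : Finset ℕ} {M : ℕ} (hA : ∀ x ∈ A, x < M) :
    gapPoly (insert M A) =
      X * ∑ B ∈ A.powerset, ∑ R ∈ avoiders B, fillingPoly A B (freeGaps R) := by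
  have hdec : gapPoly (insert M A) = ∑ q ∈ (A.powerset.sigma avoiders).sigma
      fun q => gapFillings A q.1 (freeGaps q.2), X ^ freeGaps (q.2 ++ M :: q.1.2) := by
    symm
    rw [gapPoly]
    refine sum_bij (fun q _ => q.2 ++ M :: q.1.2) ?_ ?_ ?_ fun _ _ => rfl
    · rintro ⟨⟨B, R⟩, L⟩ hq
      simp only [mem_sigma, mem_powerset] at hq
      obtain ⟨⟨hB, hR⟩, hL⟩ := hq
      exact (append_cons_mem_avoiders_iff hA hB (mem_gapFillings.1 hL).1
        (mem_avoiders.1 hR).1).2 ⟨hR, hL⟩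
    · rintro ⟨⟨B, R⟩, L⟩ hq ⟨⟨B', R'⟩, L'⟩ hq' he
      simp only [mem_sigma, mem_powerset] at hq hq'
      obtain ⟨⟨hB, hR⟩, hL⟩ := hq
      obtain ⟨⟨hB', hR'⟩, hL'⟩ := hq'
      have hM : M ∉ L := fun h => (hA M (((mem_gapFillings.1 hL).1.2 M).1 h).1).false
      have hM' : M ∉ R := fun h => (hA M (hB (((mem_avoiders.1 hR).1.2 M).1 h))).false
      simp only at he
      obtain ⟨rfl, -, rfl⟩ := (List.append_cons_inj_of_notMem hM hM').1 he
      have : B = B' := by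
        ext x
        rw [← (mem_avoiders.1 hR).1.2, ← (mem_avoiders.1 hR').1.2]
      subst this
      rfl
    · intro l hl
      obtain ⟨⟨hnd, hmem⟩, -⟩ := mem_avoiders.1 hl
      obtain ⟨L, R, rfl⟩ := List.append_of_mem ((hmem M).2 (mem_insert_self _ _))
      obtain ⟨hndL, hndR, hdisj⟩ := List.nodup_append'.1 hnd
      obtain ⟨hMR, hndR⟩ := List.nodup_cons.1 hndR
      have hML : M ∉ L := fun h => hdisj h (by simp)
      have hRA : R.toFinset ⊆ A := fun x hx => by
        rw [List.mem_toFinset] at hx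
        have := (hmem x).1 (by simp [hx])
        exact (mem_insert.1 this).resolve_left fun h => hMR (h ▸ hx)
      have hL' : L.Nodup ∧ ∀ x, x ∈ L ↔ x ∈ A ∧ x ∉ R.toFinset := by
        refine ⟨hndL, fun x => ?_⟩
        rw [List.mem_toFinset]
        constructor
        · intro hx
          have := (hmem x).1 (by simp [hx])
          exact ⟨(mem_insert.1 this).resolve_left fun h => hML (h ▸ hx),
            fun h => hdisj hx (by simp [h])⟩
        · rintro ⟨hx, hxR⟩
          have := (hmem x).2 (mem_insert_of_mem hx)
          have hxM := (hA x hx).ne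
          simpa [hxR, hxM] using this
      have hR' : R.Nodup ∧ ∀ x, x ∈ R ↔ x ∈ R.toFinset := ⟨hndR, by simp⟩
      obtain ⟨h1, h2⟩ := (append_cons_mem_avoiders_iff hA hRA hL' hR').1 hl
      exact ⟨⟨⟨R.toFinset, R⟩, L⟩, mem_sigma.2 ⟨mem_sigma.2 ⟨mem_powerset.2 hRA, h1⟩, h2⟩, rfl⟩
  rw [hdec, sum_sigma, sum_sigma, mul_sum]
  refine sum_congr rfl fun B hB => ?_
  rw [mul_sum]
  refine sum_congr rfl fun R hR => ?_
  rw [fillingPoly, mul_sum]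
  refine sum_congr rfl fun L hL => ?_
  rw [freeGaps_append_cons hA (mem_powerset.1 hB) (mem_gapFillings.1 hL).1.2
    (mem_avoiders.1 hR).1.2, pow_succ']

/-! ### The functional equation -/

/-- In a set of size `n + 1`, the numbers of elements below and above `b` run through all pairs
with sum `n` when `b` runs through the set. -/
lemma sum_card_lt_card_gt {M : Type*} [AddCommMonoid M] (A : Finset ℕ) (φ : ℕ → ℕ → M) (n : ℕ)
    (hn : #A = n + 1) :
    ∑ b ∈ A, φ #(A.filter (· < b)) #(A.filter (b < ·)) =
      ∑ q ∈ antidiagonal n, φ q.1 q.2 := by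
  have aux : ∀ (A : Finset ℕ) (φ : ℕ → ℕ → M),
      ∑ b ∈ A, φ #(A.filter (· < b)) #(A.filter (b < ·)) =
        ∑ i ∈ range #A, φ i (#A - 1 - i) := by
    intro A
    induction A using Finset.induction_on_max with
    | empty => simp
    | insert M A hM ih =>
      intro φ
      have hMA : M ∉ A := fun h => (hM M h).false
      rw [sum_insert hMA, card_insert_of_notMem hMA, sum_range_succ, add_comm]
      congr 1
      · have : ∀ b ∈ A, φ #((insert M A).filter (· < b)) #((insert M A).filter (b < ·)) =
            φ #(A.filter (· < b)) (#(A.filter (b < ·)) + 1) := by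
          intro b hb
          have hbM := hM b hb
          rw [filter_insert, filter_insert, if_neg hbM.not_gt, if_pos hbM,
            card_insert_of_notMem fun h => hMA (mem_filter.1 h).1]
        rw [sum_congr rfl this, ih fun i j => φ i (j + 1)]
        refine sum_congr rfl fun i hi => ?_
        have := mem_range.1 hi
        congr 1
        omega
      · have h1 : (insert M A).filter (· < M) = A := by
          ext x
          have := hM x
          simp only [mem_filter, mem_insert]
          constructor
          · rintro ⟨rfl | h, h'⟩
            · exact absurd h' (lt_irrefl _)
            · exact h
          · exact fun h => ⟨Or.inr h, this h⟩
        have h2 : (insert M A).filter (M < ·) = ∅ := by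
          refine filter_eq_empty_iff.2 fun x hx => ?_
          rcases mem_insert.1 hx with rfl | hx
          · exact lt_irrefl _
          · exact (hM x hx).not_gt
        rw [h1, h2, card_empty]
        congr 1
        omega
  rw [aux, hn, Finset.Nat.sum_antidiagonal_eq_sum_range_succ φ n]
  rfl

/-- The bivariate generating function of the 1342-avoiding permutations by length and number of
free gaps. -/
noncomputable def gapSeries : ℂ[X]⟦X⟧ := PowerSeries.mk fun n => gapPoly (range n)

/-- The substitution of `1` for the polynomial variable, as an endomorphism of the ring of
bivariate series. -/
noncomputable def setOne : ℂ[X]⟦X⟧ →+* ℂ[X]⟦X⟧ :=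
  PowerSeries.map (Polynomial.C.comp (Polynomial.evalRingHom 1))

/-- The polynomial variable, which marks the free gaps, as a bivariate series. -/
noncomputable def gapVar : ℂ[X]⟦X⟧ := PowerSeries.C Polynomial.X

/-- The generating function of the fillings of `k` consecutive value gaps. -/
noncomputable def fillingSeries : ℕ → ℂ[X]⟦X⟧
  | 0 => 1
  | k + 1 => gapVar * fillingSeries k + (gapSeries - gapVar) * setOne gapSeries ^ k

lemma setOne_gapVar : setOne gapVar = 1 := by
  simp [setOne, gapVar]

lemma setOne_setOne (f : ℂ[X]⟦X⟧) : setOne (setOne f) = setOne f := by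
  ext n : 1
  simp [setOne]

lemma setOne_X : setOne PowerSeries.X = PowerSeries.X := by
  simp [setOne]

lemma coeff_setOne (f : ℂ[X]⟦X⟧) (n : ℕ) :
    PowerSeries.coeff n (setOne f) = Polynomial.C ((PowerSeries.coeff n f).eval 1) := by
  simp [setOne]

lemma setOne_fillingSeries (k : ℕ) : setOne (fillingSeries k) = setOne gapSeries ^ k := by
  induction k with
  | zero => simp [fillingSeries]
  | succ k ih =>
    simp only [fillingSeries, map_add, map_mul, map_sub, map_pow, setOne_gapVar, setOne_setOne, ih]
    ring

lemma gapPoly_empty : gapPoly ∅ = Polynomial.X := by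
  simp [gapPoly, avoiders_empty, freeGaps, freeEntries]

lemma coeff_gapSeries_sub_gapVar (n : ℕ) : PowerSeries.coeff n (gapSeries - gapVar) =
    if n = 0 then 0 else gapPoly (range n) := by
  rcases n with _ | n <;> simp [gapSeries, gapVar, gapPoly_empty]

/-- The step of the recursion for `fillingSum`, in terms of series. -/
lemma coeff_X_pow_mul_fillingSeries_succ (n m k : ℕ) :
    PowerSeries.coeff (n + 1) (PowerSeries.X ^ (m + 1) * fillingSeries (k + 1)) =
      ∑ q ∈ antidiagonal n, if q.2 = 0 then
        Polynomial.X * PowerSeries.coeff q.1 (PowerSeries.X ^ m * fillingSeries k)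
        else gapPoly (range q.2) * Polynomial.C
          ((PowerSeries.coeff q.1 (PowerSeries.X ^ m * fillingSeries k)).eval 1) := by
  have hshift : (PowerSeries.X : ℂ[X]⟦X⟧) ^ (m + 1) * fillingSeries (k + 1) = PowerSeries.X *
      (gapVar * (PowerSeries.X ^ m * fillingSeries k) +
        (PowerSeries.X ^ m * setOne gapSeries ^ k) * (gapSeries - gapVar)) := by
    rw [fillingSeries]
    ring
  have hone : (PowerSeries.X : ℂ[X]⟦X⟧) ^ m * setOne gapSeries ^ k =
      setOne (PowerSeries.X ^ m * fillingSeries k) := by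
    rw [map_mul, map_pow, setOne_X, setOne_fillingSeries]
  rw [hshift, PowerSeries.coeff_succ_X_mul, map_add, hone, gapVar, PowerSeries.coeff_C_mul,
    ← gapVar,
    PowerSeries.coeff_mul n (setOne _) (gapSeries - gapVar)]
  have hsplit : ∀ q ∈ antidiagonal n, (if q.2 = 0 then
        Polynomial.X * PowerSeries.coeff q.1 (PowerSeries.X ^ m * fillingSeries k)
        else gapPoly (range q.2) * Polynomial.C
          ((PowerSeries.coeff q.1 (PowerSeries.X ^ m * fillingSeries k)).eval 1)) =
      (if q.2 = 0 then
        Polynomial.X * PowerSeries.coeff q.1 (PowerSeries.X ^ m * fillingSeries k) else 0) +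
      PowerSeries.coeff q.1 (setOne (PowerSeries.X ^ m * fillingSeries k)) *
        PowerSeries.coeff q.2 (gapSeries - gapVar) := by
    intro q _
    rw [coeff_gapSeries_sub_gapVar, coeff_setOne]
    split_ifs <;> ring
  have hfirst : ∑ q ∈ antidiagonal n, (if q.2 = 0 then
      Polynomial.X * PowerSeries.coeff q.1 (PowerSeries.X ^ m * fillingSeries k) else 0) =
      Polynomial.X * PowerSeries.coeff n (PowerSeries.X ^ m * fillingSeries k) := by
    rw [sum_eq_single (n, 0), if_pos rfl]
    · rintro ⟨i, j⟩ hq hne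
      refine if_neg ?_
      rintro rfl
      have := HasAntidiagonal.mem_antidiagonal.1 hq
      exact hne (by rw [← this, add_zero])
    · simp
  rw [sum_congr rfl hsplit, sum_add_distrib, hfirst]

/-- The number of fillings depends on sizes only, as long as this holds for the smaller blocks
that are filled in. The bound on `k` says that `m` elements have only `m + 1` gaps. -/
lemma fillingSum_eq_coeff {N : ℕ} (hN : ∀ A : Finset ℕ, #A ≤ N → gapPoly A = gapPoly (range #A))
    (k : ℕ) : ∀ (m : ℕ) (A : Finset ℕ), #A ≤ N → k ≤ m + 1 →
      fillingSum A m k = PowerSeries.coeff #A (PowerSeries.X ^ m * fillingSeries k) := by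
  induction k with
  | zero =>
    intro m A _ _
    have h : ∀ B ∈ A.powersetCard m, fillingPoly A B 0 = if B = A then 1 else 0 :=
      fun B hB => fillingPoly_zero (mem_powersetCard.1 hB).1
    rw [fillingSum, sum_congr rfl h, sum_ite_eq', fillingSeries, mul_one, PowerSeries.coeff_X_pow]
    simp [mem_powersetCard]
  | succ k ih =>
    intro m A hA hk
    rcases m with _ | m
    · obtain rfl : k = 0 := by omega
      rw [fillingSum, powersetCard_zero, sum_singleton, fillingPoly_empty_one, hN A hA]
      simp [fillingSeries, gapSeries]
    · rcases hn : #A with _ | n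
      · rw [card_eq_zero.1 hn, pow_succ', mul_assoc, PowerSeries.coeff_zero_X_mul]
        rw [fillingSum, powersetCard_eq_empty.2 (by simp), sum_empty]
      · rw [fillingSum_succ, coeff_X_pow_mul_fillingSeries_succ]
        have hsum := sum_card_lt_card_gt A (fun i j : ℕ => if j = 0 then
          Polynomial.X * PowerSeries.coeff i (PowerSeries.X ^ m * fillingSeries k)
          else gapPoly (range j) * Polynomial.C (Polynomial.eval 1
            (PowerSeries.coeff i (PowerSeries.X ^ m * fillingSeries k)))) n hn
        rw [← hsum]
        refine sum_congr rfl fun b _ => ?_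
        have h1 : #(A.filter (· < b)) ≤ N := (card_filter_le _ _).trans hA
        have h2 : #(A.filter (b < ·)) ≤ N := (card_filter_le _ _).trans hA
        simp only [card_eq_zero]
        rw [ih m _ h1 (by omega), hN _ h2]

/-- The sum of `x ^ m * φ k` over all 1342-avoiding permutations, where `m` is the length and `k` the
number of free gaps. Lengths `m > n` do not contribute to the coefficient of `x ^ n`. -/
noncomputable def sumOverGaps (φ : ℕ → ℂ[X]⟦X⟧) : ℂ[X]⟦X⟧ :=
  PowerSeries.mk fun n => PowerSeries.coeff n (∑ m ∈ range (n + 1), PowerSeries.X ^ m *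
    ∑ k ∈ range (m + 2), PowerSeries.C (Polynomial.C ((gapPoly (range m)).coeff k)) * φ k)

lemma coeff_sumOverGaps (φ : ℕ → ℂ[X]⟦X⟧) {n N : ℕ} (h : n ≤ N) :
    PowerSeries.coeff n (sumOverGaps φ) =
      PowerSeries.coeff n (∑ m ∈ range (N + 1), PowerSeries.X ^ m *
        ∑ k ∈ range (m + 2), PowerSeries.C (Polynomial.C ((gapPoly (range m)).coeff k)) * φ k) := by
  rw [sumOverGaps, PowerSeries.coeff_mk, map_sum, map_sum]
  refine sum_subset (fun m hm => ?_) fun m _ hm => ?_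
  · simp only [mem_range] at hm ⊢
    omega
  · rw [PowerSeries.coeff_X_pow_mul', if_neg]
    simp only [mem_range] at hm
    omega

lemma gapPoly_insert_eq_coeff {A : Finset ℕ} {M : ℕ} (hA : ∀ x ∈ A, x < M)
    (hN : ∀ B : Finset ℕ, #B ≤ #A → gapPoly B = gapPoly (range #B)) :
    gapPoly (insert M A) =
      Polynomial.X * PowerSeries.coeff #A (sumOverGaps fillingSeries) := by
  rw [gapPoly_insert hA, coeff_sumOverGaps fillingSeries le_rfl, map_sum, sum_powerset]
  congr 1
  refine sum_congr rfl fun m hm => ?_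
  have hm : m ≤ #A := by
    have := mem_range.1 hm
    omega
  have h1 : ∀ B ∈ A.powersetCard m, ∑ R ∈ avoiders B, fillingPoly A B (freeGaps R) =
      ∑ k ∈ range (m + 2), Polynomial.C ((gapPoly (range m)).coeff k) * fillingPoly A B k := by
    intro B hB
    have hc := (mem_powersetCard.1 hB).2
    rw [sum_avoiders_freeGaps B (fillingPoly A B), hN B (by omega), hc]
  rw [sum_congr rfl h1, sum_comm, mul_sum, map_sum]
  refine sum_congr rfl fun k hk => ?_
  rw [← mul_sum, ← fillingSum, fillingSum_eq_coeff hN k m A le_rfl, mul_left_comm,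
    PowerSeries.coeff_C_mul]
  have := mem_range.1 hk
  omega

/-- The generating polynomial depends on the size of the set only. -/
lemma gapPoly_eq_gapPoly_range (A : Finset ℕ) : gapPoly A = gapPoly (range #A) := by
  induction hn : #A using Nat.strong_induction_on generalizing A with
  | _ n ih =>
    rcases n with _ | n
    · rw [card_eq_zero.1 hn, range_zero]
    · have hN : ∀ B : Finset ℕ, #B ≤ n → gapPoly B = gapPoly (range #B) :=
        fun B hB => ih _ (Nat.lt_succ_of_le hB) B rfl
      have hne : A.Nonempty := card_pos.1 (by omega)
      have hc : #(A.erase (A.max' hne)) = n := by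
        rw [card_erase_of_mem (max'_mem _ _), hn, Nat.add_sub_cancel]
      have h1 := gapPoly_insert_eq_coeff (A := A.erase (A.max' hne)) (M := A.max' hne)
        (fun x hx => lt_max'_of_mem_erase_max' A hne hx) (by rwa [hc])
      rw [insert_erase (max'_mem _ _), hc] at h1
      have h2 := gapPoly_insert_eq_coeff (A := range n) (M := n) (fun x hx => mem_range.1 hx)
        (by rwa [card_range])
      rw [card_range, ← range_add_one] at h2
      rw [h1, h2]

lemma gapSeries_eq_add_sumOverGaps :
    gapSeries = gapVar + gapVar * PowerSeries.X * sumOverGaps fillingSeries := by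
  ext n : 1
  rcases n with _ | n
  · simp [gapSeries, gapVar, gapPoly_empty]
  · have h := gapPoly_insert_eq_coeff (A := range n) (M := n) (fun x hx => mem_range.1 hx)
      fun B _ => gapPoly_eq_gapPoly_range B
    rw [card_range, ← range_add_one] at h
    rw [gapSeries, PowerSeries.coeff_mk, h, map_add, mul_assoc, gapVar, PowerSeries.coeff_C_mul,
      PowerSeries.coeff_succ_X_mul, PowerSeries.coeff_C, if_neg (Nat.succ_ne_zero n), zero_add]

lemma sumOverGaps_mul (c : ℂ[X]⟦X⟧) (φ : ℕ → ℂ[X]⟦X⟧) :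
    sumOverGaps (fun k => c * φ k) = c * sumOverGaps φ := by
  ext n : 1
  rw [coeff_sumOverGaps _ le_rfl, PowerSeries.coeff_mul]
  have h : ∑ q ∈ antidiagonal n, PowerSeries.coeff q.1 c * PowerSeries.coeff q.2 (sumOverGaps φ) =
      PowerSeries.coeff n (c * ∑ m ∈ range (n + 1), PowerSeries.X ^ m * ∑ k ∈ range (m + 2),
        PowerSeries.C (Polynomial.C ((gapPoly (range m)).coeff k)) * φ k) := by
    rw [PowerSeries.coeff_mul]
    refine sum_congr rfl fun q hq => ?_
    have := HasAntidiagonal.mem_antidiagonal.1 hq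
    rw [coeff_sumOverGaps φ (show q.2 ≤ n by omega)]
  rw [h]
  simp only [mul_sum, mul_left_comm c]

lemma sumOverGaps_sub (φ ψ : ℕ → ℂ[X]⟦X⟧) :
    sumOverGaps (fun k => φ k - ψ k) = sumOverGaps φ - sumOverGaps ψ := by
  ext n : 1
  simp only [sumOverGaps, PowerSeries.coeff_mk, map_sub, mul_sub, sum_sub_distrib]

lemma sumOverGaps_gapVar_pow : sumOverGaps (fun k => gapVar ^ k) = gapSeries := by
  ext n : 1
  have hpoly : ∀ m, ∑ k ∈ range (m + 2),
      PowerSeries.C (Polynomial.C ((gapPoly (range m)).coeff k)) * gapVar ^ k =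
        PowerSeries.C (gapPoly (range m)) := by
    intro m
    conv_rhs => rw [(gapPoly (range m)).as_sum_range_C_mul_X_pow' (n := m + 2)
      (Nat.lt_succ_of_le (by simpa using natDegree_gapPoly_le (range m)))]
    simp [gapVar]
  rw [coeff_sumOverGaps _ le_rfl]
  simp only [hpoly, map_sum, PowerSeries.coeff_mul_C, PowerSeries.coeff_X_pow, gapSeries,
    PowerSeries.coeff_mk, ite_mul, one_mul, zero_mul, sum_ite_eq]
  simp

lemma setOne_sumOverGaps (φ : ℕ → ℂ[X]⟦X⟧) :
    setOne (sumOverGaps φ) = sumOverGaps fun k => setOne (φ k) := by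
  ext n : 1
  have : ∀ (f : ℂ[X]⟦X⟧), PowerSeries.coeff n (setOne f) =
    Polynomial.C ((PowerSeries.coeff n f).eval 1) := fun f => coeff_setOne f n
  rw [this, coeff_sumOverGaps _ le_rfl, ← this, coeff_sumOverGaps _ le_rfl]
  have hC : ∀ c : ℂ, setOne (PowerSeries.C (Polynomial.C c)) = PowerSeries.C (Polynomial.C c) := by
    intro c
    simp [setOne]
  simp only [map_sum, map_mul, map_pow, setOne_X, hC]

lemma sub_mul_fillingSeries (k : ℕ) : (gapVar - setOne gapSeries) * fillingSeries k =
    (gapSeries - setOne gapSeries) * gapVar ^ k -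
      (gapSeries - gapVar) * setOne gapSeries ^ k := by
  induction k with
  | zero => simp [fillingSeries]
  | succ k ih =>
    rw [fillingSeries]
    linear_combination gapVar * ih

/-- The functional equation with catalytic variable `gapVar`, in which the unknown univariate
series is the value of `gapSeries` at `gapVar = 1`. -/
theorem gapSeries_quadratic :
    PowerSeries.X * gapVar * gapSeries ^ 2 +
      setOne gapSeries * (1 - gapVar - PowerSeries.X * gapVar) * gapSeries -
      gapVar * setOne gapSeries * (1 - gapVar) = 0 := by
  have h1 := gapSeries_eq_add_sumOverGaps
  have h2 : setOne gapSeries = 1 + PowerSeries.X *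
      sumOverGaps fun k => setOne gapSeries ^ k := by
    conv_lhs => rw [h1]
    simp only [map_add, map_mul, setOne_gapVar, setOne_X, setOne_sumOverGaps,
      setOne_fillingSeries, one_mul]
  have h3 : (gapVar - setOne gapSeries) * sumOverGaps fillingSeries =
      (gapSeries - setOne gapSeries) * gapSeries -
        (gapSeries - gapVar) * sumOverGaps fun k => setOne gapSeries ^ k := by
    rw [← sumOverGaps_mul]
    simp only [sub_mul_fillingSeries]
    rw [sumOverGaps_sub, sumOverGaps_mul, sumOverGaps_mul, sumOverGaps_gapVar_pow]
  linear_combination (setOne gapSeries - gapVar) * h1 - gapVar * PowerSeries.X * h3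
    - gapVar * (gapSeries - gapVar) * h2

/-! ### Solution of the functional equation -/

/-- The Catalan series at `2x`, in terms of which `√(1 - 8x)` is expressed. -/
noncomputable def catalanTwo : ℂ⟦X⟧ :=
  PowerSeries.rescale 2 (PowerSeries.map (Nat.castRingHom ℂ) PowerSeries.catalanSeries)

lemma catalanTwo_eq : catalanTwo = 1 + 2 * PowerSeries.X * catalanTwo ^ 2 := by
  have h1 := congrArg (PowerSeries.map (Nat.castRingHom ℂ))
    PowerSeries.catalanSeries_sq_mul_X_add_one
  rw [map_add, map_mul, map_pow, map_one, PowerSeries.map_X] at h1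
  have h2 := congrArg (PowerSeries.rescale (2 : ℂ)) h1
  rw [map_add, map_mul, map_pow, map_one, PowerSeries.rescale_X, ← catalanTwo, map_ofNat] at h2
  linear_combination -h2

/-- The power series `√(1 - 8x)`. -/
noncomputable def sqrtSeries : ℂ⟦X⟧ := 1 - 4 * PowerSeries.X * catalanTwo

lemma sqrtSeries_sq : sqrtSeries ^ 2 = 1 - 8 * PowerSeries.X := by
  rw [sqrtSeries]
  linear_combination -8 * PowerSeries.X * catalanTwo_eq

lemma constantCoeff_sqrtSeries : PowerSeries.constantCoeff sqrtSeries = 1 := by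
  simp [sqrtSeries]

/-- The series `(3 + √(1 - 8x)) / 4`, which parametrizes the solution of the functional equation
rationally: `x = (1 - t) (2 t - 1)` for `t = paramSeries`. -/
noncomputable def paramSeries : ℂ⟦X⟧ := 1 - PowerSeries.X * catalanTwo

lemma four_mul_paramSeries : 4 * paramSeries = 3 + sqrtSeries := by
  rw [paramSeries, sqrtSeries]
  ring

lemma X_eq_paramSeries : PowerSeries.X = (1 - paramSeries) * (2 * paramSeries - 1) := by
  rw [paramSeries]
  linear_combination -PowerSeries.X * catalanTwo_eq

lemma constantCoeff_paramSeries : PowerSeries.constantCoeff paramSeries = 1 := by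
  simp [paramSeries]

lemma paramSeries_mul_inv : paramSeries * paramSeries⁻¹ = 1 :=
  PowerSeries.mul_inv_cancel _ (by simp [constantCoeff_paramSeries])

/-- Univariate series as bivariate series. -/
noncomputable def toBivariate : ℂ⟦X⟧ →+* ℂ[X]⟦X⟧ := PowerSeries.map Polynomial.C

lemma toBivariate_injective : Function.Injective toBivariate :=
  PowerSeries.map_injective _ Polynomial.C_injective

lemma setOne_toBivariate (f : ℂ⟦X⟧) : setOne (toBivariate f) = toBivariate f := by
  ext n : 1
  simp [setOne, toBivariate]

lemma toBivariate_X : toBivariate PowerSeries.X = PowerSeries.X := PowerSeries.map_X _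

lemma constantCoeff_toBivariate (f : ℂ⟦X⟧) : PowerSeries.constantCoeff (toBivariate f) =
    Polynomial.C (PowerSeries.constantCoeff f) := by
  rw [← PowerSeries.coeff_zero_eq_constantCoeff_apply, ← PowerSeries.coeff_zero_eq_constantCoeff_apply,
    toBivariate, PowerSeries.coeff_map]

/-- There is a Catalan series of every power series without constant term. -/
lemma exists_catalan_subst (z : ℂ[X]⟦X⟧) (hz : PowerSeries.constantCoeff z = 0) :
    ∃ c : ℂ[X]⟦X⟧, c = 1 + z * c ^ 2 := by
  have hs : PowerSeries.HasSubst z := PowerSeries.HasSubst.of_constantCoeff_zero' hz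
  have h := congrArg (fun f => PowerSeries.substAlgHom (R := ℂ) hs
    (PowerSeries.map (Nat.castRingHom ℂ) f)) PowerSeries.catalanSeries_sq_mul_X_add_one
  simp only [map_add, map_mul, map_pow, map_one, PowerSeries.map_X,
    PowerSeries.coe_substAlgHom] at h
  rw [PowerSeries.subst_X hs] at h
  exact ⟨_, by rw [add_comm, mul_comm]; exact h.symm⟩

/-- The functional equation has at most one solution, since it determines the coefficients of the
series one after the other. -/
lemma eq_of_quadratic {F G : ℂ[X]⟦X⟧}
    (hF : PowerSeries.X * gapVar * F ^ 2 +
      setOne F * (1 - gapVar - PowerSeries.X * gapVar) * F - gapVar * setOne F * (1 - gapVar) = 0)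
    (hG : PowerSeries.X * gapVar * G ^ 2 +
      setOne G * (1 - gapVar - PowerSeries.X * gapVar) * G - gapVar * setOne G * (1 - gapVar) = 0)
    (hF0 : PowerSeries.constantCoeff F = Polynomial.X)
    (hG0 : PowerSeries.constantCoeff G = Polynomial.X) : F = G := by
  have hdvd : ∀ n, PowerSeries.X ^ n ∣ F - G := by
    intro n
    induction n with
    | zero => simp
    | succ n ih =>
      obtain ⟨D, hD⟩ := ih
      have hE : setOne F - setOne G = PowerSeries.X ^ n * setOne D := by
        rw [← map_sub, hD, map_mul, map_pow, setOne_X]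
      have hXn : (PowerSeries.X : ℂ[X]⟦X⟧) ^ n ≠ 0 := pow_ne_zero _ PowerSeries.X_ne_zero
      have key : PowerSeries.X * gapVar * (F + G) * D +
          setOne D * (1 - gapVar - PowerSeries.X * gapVar) * F +
          setOne G * (1 - gapVar - PowerSeries.X * gapVar) * D -
          gapVar * (1 - gapVar) * setOne D = 0 := by
        refine (mul_eq_zero.1 ?_).resolve_left hXn
        linear_combination hF - hG - (PowerSeries.X * gapVar * (F + G) +
          setOne G * (1 - gapVar - PowerSeries.X * gapVar)) * hD -
          ((1 - gapVar - PowerSeries.X * gapVar) * F - gapVar * (1 - gapVar)) * hE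
      have hG1 : PowerSeries.constantCoeff (setOne G) = 1 := by
        rw [← PowerSeries.coeff_zero_eq_constantCoeff_apply, coeff_setOne,
          PowerSeries.coeff_zero_eq_constantCoeff_apply, hG0]
        simp
      have h0 := congrArg PowerSeries.constantCoeff key
      simp only [map_add, map_sub, map_mul, map_one, map_zero, PowerSeries.constantCoeff_X, hF0,
        hG0, hG1, gapVar, PowerSeries.constantCoeff_C] at h0
      have h1 : (1 - Polynomial.X : ℂ[X]) * PowerSeries.constantCoeff D = 0 := by
        linear_combination h0
      have hne : (1 - Polynomial.X : ℂ[X]) ≠ 0 := fun h => by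
        have := congrArg (Polynomial.eval 0) h
        simp at this
      obtain ⟨D', rfl⟩ := PowerSeries.X_dvd_iff.2 ((mul_eq_zero.1 h1).resolve_left hne)
      exact ⟨D', by rw [hD]; ring⟩
  rw [← sub_eq_zero]
  ext n : 1
  exact PowerSeries.X_pow_dvd_iff.1 (hdvd (n + 1)) n (Nat.lt_succ_self n)

/-- In the parameter `t = 1 / s`, the functional equation has a solution that is a polynomial in the
Catalan series `c` of `v t (1 - t)`, where `v` is the catalytic variable. -/
lemma quadratic_solution {R : Type*} [CommRing R] {x t s v c : R} (hx : x = (1 - t) * (2 * t - 1))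
    (hs : t * s = 1) (hc : c = 1 + v * t * (1 - t) * c ^ 2) :
    x * v * (s ^ 2 * (1 + (v * t - 1) * c)) ^ 2 +
      s ^ 3 * (2 * t - 1) * (1 - v - x * v) * (s ^ 2 * (1 + (v * t - 1) * c)) -
      v * (s ^ 3 * (2 * t - 1)) * (1 - v) = 0 := by
  subst hx
  linear_combination -s ^ 5 * (2 * t - 1) * (v * t - 1) ^ 2 * hc +
    (-((1 - t) * (2 * t - 1) * v * s ^ 4 * (1 + (v * t - 1) * c) ^ 2) +
      v * s ^ 3 * (2 * t - 1) * (1 - v) * (1 + t * s)) * hs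

/-- The solution of the functional equation at `gapVar = 1`. -/
theorem setOne_gapSeries :
    setOne gapSeries = toBivariate (paramSeries⁻¹ ^ 3 * (2 * paramSeries - 1)) := by
  set t := toBivariate paramSeries with ht
  set s := toBivariate paramSeries⁻¹ with hs
  have hts : t * s = 1 := by
    rw [ht, hs, ← map_mul, paramSeries_mul_inv, map_one]
  have hX : (PowerSeries.X : ℂ[X]⟦X⟧) = (1 - t) * (2 * t - 1) := by
    have := congrArg toBivariate X_eq_paramSeries
    simpa only [toBivariate_X, map_mul, map_sub, map_one, map_ofNat] using this
  have ht0 : PowerSeries.constantCoeff t = 1 := by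
    rw [ht, constantCoeff_toBivariate, constantCoeff_paramSeries, map_one]
  have hs0 : PowerSeries.constantCoeff s = 1 := by
    have := congrArg PowerSeries.constantCoeff hts
    rwa [map_mul, ht0, one_mul, map_one] at this
  have hst : setOne t = t := setOne_toBivariate _
  have hss : setOne s = s := setOne_toBivariate _
  obtain ⟨c, hc⟩ := exists_catalan_subst (gapVar * t * (1 - t)) (by simp [ht0])
  have hc0 : PowerSeries.constantCoeff c = 1 := by
    have := congrArg PowerSeries.constantCoeff hc
    simpa [ht0] using this
  -- At `gapVar = 1`, the two roots of the equation of `c` are `s` and a series with a pole.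
  have hcs : setOne c = s := by
    have h1 := congrArg setOne hc
    simp only [map_add, map_mul, map_sub, map_pow, map_one, setOne_gapVar, hst, one_mul] at h1
    have h2 : (setOne c - s) * (1 - t * (1 - t) * (setOne c + s)) = 0 := by
      linear_combination h1 + (-1 + (1 - t) * s) * hts
    refine sub_eq_zero.1 ((mul_eq_zero.1 h2).resolve_right fun h => ?_)
    have := congrArg PowerSeries.constantCoeff h
    simp [ht0] at this
  have hone : setOne (s ^ 2 * (1 + (gapVar * t - 1) * c)) = s ^ 3 * (2 * t - 1) := by
    simp only [map_add, map_mul, map_sub, map_pow, map_one, setOne_gapVar, hst, hss, hcs]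
    linear_combination -s ^ 2 * hts
  have hsol : gapSeries = s ^ 2 * (1 + (gapVar * t - 1) * c) := by
    refine eq_of_quadratic gapSeries_quadratic ?_ ?_ ?_
    · rw [hone]
      exact quadratic_solution hX hts hc
    · rw [gapSeries, ← PowerSeries.coeff_zero_eq_constantCoeff_apply, PowerSeries.coeff_mk,
        range_zero, gapPoly_empty]
    · simp [hs0, ht0, hc0, gapVar]
  rw [hsol, hone, map_mul, map_pow, map_sub, map_mul, map_one, map_ofNat]

/-- The counting series of the 1342-avoiding words. -/
noncomputable def avoiderSeries : ℂ⟦X⟧ := PowerSeries.mk fun n => (#(avoiders (range n)) : ℂ)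

lemma setOne_gapSeries_eq_avoiderSeries : setOne gapSeries = toBivariate avoiderSeries := by
  ext n : 1
  rw [coeff_setOne]
  simp [gapSeries, toBivariate, avoiderSeries, gapPoly, Polynomial.eval_finsetSum]

/-- Closed form of the generating function. -/
theorem avoiderSeries_closed_form :
    2 * (1 + PowerSeries.X) ^ 3 * avoiderSeries =
      1 + 20 * PowerSeries.X - 8 * PowerSeries.X ^ 2 + (1 - 8 * PowerSeries.X) * sqrtSeries := by
  have h : avoiderSeries = paramSeries⁻¹ ^ 3 * (2 * paramSeries - 1) :=
    toBivariate_injective (setOne_gapSeries_eq_avoiderSeries.symm.trans setOne_gapSeries)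
  -- The conjugate `3 / 2 - t` of `t` satisfies `2 t (3 / 2 - t) = 1 + x`.
  have hconj : 1 + PowerSeries.X = paramSeries * (3 - 2 * paramSeries) := by
    rw [X_eq_paramSeries]
    ring
  have h3 : paramSeries ^ 3 * avoiderSeries = 2 * paramSeries - 1 := by
    rw [h, ← mul_assoc, ← mul_pow, paramSeries_mul_inv, one_pow, one_mul]
  have h4 : (1 + PowerSeries.X) ^ 3 * avoiderSeries =
      (3 - 2 * paramSeries) ^ 3 * (2 * paramSeries - 1) := by
    rw [hconj, mul_pow]
    linear_combination (3 - 2 * paramSeries) ^ 3 * h3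
  have h8 : (8 : ℂ⟦X⟧) ≠ 0 := fun h => by
    have := congrArg PowerSeries.constantCoeff h
    rw [map_ofNat, map_zero] at this
    norm_num at this
  refine mul_left_cancel₀ h8 ?_
  have h5 : 16 * ((1 + PowerSeries.X) ^ 3 * avoiderSeries) =
      (6 - 4 * paramSeries) ^ 3 * (4 * paramSeries - 2) := by
    rw [h4]
    ring
  rw [four_mul_paramSeries] at h5
  linear_combination h5 + (-sqrtSeries ^ 2 + 8 * sqrtSeries - (19 - 8 * PowerSeries.X)) *
    sqrtSeries_sq

/-! ### Words and permutations -/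

/-- The word of the values of a permutation. -/
def permWord {n : ℕ} (p : Equiv.Perm (Fin n)) : List ℕ := List.ofFn fun i => (p i : ℕ)

lemma permWord_spec {n : ℕ} (p : Equiv.Perm (Fin n)) :
    (permWord p).Nodup ∧ ∀ x, x ∈ permWord p ↔ x ∈ range n := by
  refine ⟨List.nodup_ofFn_ofInjective (Fin.val_injective.comp p.injective), fun x => ?_⟩
  rw [permWord, List.mem_ofFn, mem_range]
  constructor
  · rintro ⟨i, rfl⟩
    exact (p i).2
  · intro hx
    exact ⟨p.symm ⟨x, hx⟩, by simp⟩

lemma permWord_injective (n : ℕ) : Function.Injective (permWord (n := n)) := fun p q h => by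
  ext i
  exact congrFun (List.ofFn_injective h) i

lemma exists_permWord_eq {n : ℕ} {l : List ℕ} (h : l.Nodup ∧ ∀ x, x ∈ l ↔ x ∈ range n) :
    ∃ p : Equiv.Perm (Fin n), permWord p = l := by
  have hlen : l.length = n := (length_of_mem_words h).trans (card_range n)
  subst hlen
  let f : Fin l.length → Fin l.length := fun i => ⟨l[i], mem_range.1 ((h.2 _).1 (l.getElem_mem _))⟩
  have hf : Function.Injective f := fun i j hij => by
    have : l[(i : ℕ)] = l[(j : ℕ)] := congrArg Fin.val hij
    exact Fin.ext ((h.1.getElem_inj_iff).1 this)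
  refine ⟨Equiv.ofBijective f (Finite.injective_iff_bijective.1 hf), ?_⟩
  rw [permWord]
  exact List.ofFn_getElem

lemma containsPattern_iff_not_free1342 {n : ℕ} (p : Equiv.Perm (Fin n)) :
    ContainsPattern p pattern1342 ↔ ¬ Free1342 (permWord p) := by
  have hlen : (permWord p).length = n := List.length_ofFn
  constructor
  · rintro ⟨e, he, hp⟩ hfree
    have hval : ∀ i j : Fin 4, ((p (e i) : ℕ) < p (e j) ↔ pattern1342 i < pattern1342 j) :=
      fun i j => Fin.lt_def.symm.trans (hp i j)
    refine hfree (p (e 0)) (p (e 1)) (p (e 2)) (p (e 3)) ?_ ((hval 0 3).2 (by decide))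
      ((hval 3 1).2 (by decide)) ((hval 1 2).2 (by decide))
    refine List.sublist_iff_exists_fin_orderEmbedding_get_eq.2
      ⟨OrderEmbedding.ofStrictMono (fun i : Fin 4 => Fin.cast hlen.symm (e i)) fun i j hij => he hij,
        fun i => ?_⟩
    change Fin 4 at i
    fin_cases i <;> simp [permWord] <;> rfl
  · intro h
    simp only [Free1342, not_forall, not_not] at h
    obtain ⟨a, b, c, d, hs, had, hdb, hbc⟩ := h
    obtain ⟨f, hf⟩ := List.sublist_iff_exists_fin_orderEmbedding_get_eq.1 hs
    have hp : ∀ i : Fin 4, [a, b, c, d].get i = p (Fin.cast hlen (f i)) := fun i => by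
      rw [hf i]
      simp [permWord]
      rfl
    refine ⟨fun i => Fin.cast hlen (f i), fun i j hij => f.strictMono hij, fun i j => ?_⟩
    rw [Fin.lt_def, ← hp, ← hp]
    have hq : ∀ i, pattern1342 i = ![0, 2, 3, 1] i := fun _ => rfl
    fin_cases i <;> fin_cases j <;> simp [hq] <;> omega

lemma avoidCount_eq_card_avoiders (n : ℕ) : avoidCount pattern1342 n = #(avoiders (range n)) := by
  have hmem : ∀ p : Equiv.Perm (Fin n), ¬ ContainsPattern p pattern1342 ↔
      permWord p ∈ avoiders (range n) := fun p => by
    rw [containsPattern_iff_not_free1342, not_not, mem_avoiders, and_iff_right (permWord_spec p)]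
  let f : {p : Equiv.Perm (Fin n) // ¬ ContainsPattern p pattern1342} → avoiders (range n) :=
    fun p => ⟨permWord p.1, (hmem p.1).1 p.2⟩
  have hf : Function.Bijective f := by
    refine ⟨fun p q h => Subtype.ext (permWord_injective n (congrArg Subtype.val h)), fun l => ?_⟩
    obtain ⟨p, hp⟩ := exists_permWord_eq (mem_avoiders.1 l.2).1
    exact ⟨⟨p, (hmem p).2 (hp ▸ l.2)⟩, Subtype.ext hp⟩
  rw [avoidCount, Nat.card_eq_of_bijective f hf, Nat.card_eq_fintype_card, Fintype.card_coe]

theorem genFun1342_closed_form :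
    2 * (1 + PowerSeries.X) ^ 3 * genFun1342 =
      1 + 20 * PowerSeries.X - 8 * PowerSeries.X ^ 2 + (1 - 8 * PowerSeries.X) * sqrtSeries := by
  have : genFun1342 = avoiderSeries := by
    ext n
    simp [genFun1342, avoiderSeries, avoidCount_eq_card_avoiders]
  rw [this, avoiderSeries_closed_form]

/-! ### Consequences of the closed form -/

/-- A linear differential equation for the generating function. -/
lemma genFun1342_differential_equation :
    (1 - 8 * PowerSeries.X) * (1 + PowerSeries.X) * PowerSeries.derivative ℂ genFun1342 +
      (15 - 12 * PowerSeries.X) * genFun1342 = 16 := by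
  have hF := genFun1342_closed_form
  have hdF := congrArg (PowerSeries.derivative ℂ) hF
  have hdr := congrArg (PowerSeries.derivative ℂ) sqrtSeries_sq
  have hnat : ∀ k : ℕ, PowerSeries.derivative ℂ (k : ℂ⟦X⟧) = 0 :=
    fun k => Derivation.map_natCast _ k
  have h2 : PowerSeries.derivative ℂ (2 : ℂ⟦X⟧) = 0 := hnat 2
  have h8 : PowerSeries.derivative ℂ (8 : ℂ⟦X⟧) = 0 := hnat 8
  have h20 : PowerSeries.derivative ℂ (20 : ℂ⟦X⟧) = 0 := hnat 20
  simp only [Derivation.leibniz, Derivation.leibniz_pow, map_add, map_sub, smul_eq_mul,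
    Derivation.map_one_eq_zero, PowerSeries.derivative_X, h2, h8, h20, nsmul_eq_mul] at hdF hdr
  have hne : ∀ f : ℂ⟦X⟧, PowerSeries.constantCoeff f = 2 → f ≠ 0 := fun f hf h => by
    simp [h] at hf
  have hdr' : (1 - 8 * PowerSeries.X) * PowerSeries.derivative ℂ sqrtSeries = -4 * sqrtSeries := by
    refine mul_left_cancel₀ (hne 2 (map_ofNat _ 2)) ?_
    linear_combination sqrtSeries * hdr - 2 * PowerSeries.derivative ℂ sqrtSeries * sqrtSeries_sq
  refine mul_left_cancel₀ (hne (2 * (1 + PowerSeries.X) ^ 2) ?_) ?_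
  · rw [map_mul, map_ofNat]
    simp
  · linear_combination (1 - 8 * PowerSeries.X) * hdF + 12 * hF + (1 - 8 * PowerSeries.X) * hdr'

/-- The three-term recurrence for the number of 1342-avoiding permutations. -/
lemma avoidCount_recurrence (n : ℕ) :
    ((n : ℂ) + 2) * avoidCount pattern1342 (n + 2) +
      (8 - 7 * n) * avoidCount pattern1342 (n + 1) -
      (8 * n + 12) * avoidCount pattern1342 n = 0 := by
  have hode := genFun1342_differential_equation
  have hexp : PowerSeries.derivative ℂ genFun1342 -
      PowerSeries.C (7 : ℂ) * (PowerSeries.X * PowerSeries.derivative ℂ genFun1342) -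
      PowerSeries.C (8 : ℂ) * (PowerSeries.X * (PowerSeries.X * PowerSeries.derivative ℂ genFun1342)) +
      PowerSeries.C (15 : ℂ) * genFun1342 - PowerSeries.C (12 : ℂ) * (PowerSeries.X * genFun1342) =
      PowerSeries.C (16 : ℂ) := by
    simp only [map_ofNat]
    linear_combination hode
  have hX : PowerSeries.coeff n ((PowerSeries.X : ℂ⟦X⟧) * PowerSeries.derivative ℂ genFun1342) =
      n * avoidCount pattern1342 n := by
    rcases n with _ | n
    · simp
    · rw [PowerSeries.coeff_succ_X_mul, PowerSeries.coeff_derivative, genFun1342,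
        PowerSeries.coeff_mk]
      push_cast
      ring
  have hc := congrArg (PowerSeries.coeff (n + 1)) hexp
  simp only [map_add, map_sub, PowerSeries.coeff_C_mul, PowerSeries.coeff_succ_X_mul, hX,
    PowerSeries.coeff_derivative, PowerSeries.coeff_C, if_neg (Nat.succ_ne_zero n)] at hc
  simp only [genFun1342, PowerSeries.coeff_mk] at hc
  push_cast at hc
  linear_combination hc

lemma isPRecursive_avoidCount : IsPRecursive fun n => (avoidCount pattern1342 n : ℂ) := by
  refine ⟨2, fun j => if j = 0 then -(8 * Polynomial.X + 12) else
    if j = 1 then 8 - 7 * Polynomial.X else Polynomial.X + 2, ?_, fun n => ?_⟩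
  · intro h
    have := congrArg (Polynomial.eval 0) h
    simp at this
  · simp only [sum_range_succ, range_zero, sum_empty]
    have h2 : Polynomial.aeval (n : ℂ) (2 : ℚ[X]) = 2 := map_ofNat _ 2
    have h7 : Polynomial.aeval (n : ℂ) (7 : ℚ[X]) = 7 := map_ofNat _ 7
    have h8 : Polynomial.aeval (n : ℂ) (8 : ℚ[X]) = 8 := map_ofNat _ 8
    have h12 : Polynomial.aeval (n : ℂ) (12 : ℚ[X]) = 12 := map_ofNat _ 12
    simp [h2, h7, h8, h12]
    linear_combination avoidCount_recurrence n

lemma coe_ofNat_powerSeries (k : ℕ) [k.AtLeastTwo] :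
    ((ofNat(k) : ℂ[X]) : ℂ⟦X⟧) = ofNat(k) :=
  map_ofNat Polynomial.coeToPowerSeries.ringHom k

lemma isAlgebraic_genFun1342 : IsAlgebraic ℂ[X] genFun1342 := by
  -- Squaring the closed form removes the square root.
  refine ⟨(Polynomial.C (2 * (1 + Polynomial.X) ^ 3) * Polynomial.X -
      Polynomial.C (1 + 20 * Polynomial.X - 8 * Polynomial.X ^ 2)) ^ 2 -
      Polynomial.C ((1 - 8 * Polynomial.X) ^ 3), fun h => ?_, ?_⟩
  · have := congrArg (fun p => Polynomial.eval 1 (Polynomial.eval 0 p)) h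
    norm_num at this
  · have hF := genFun1342_closed_form
    have hmap : ∀ p : ℂ[X], algebraMap ℂ[X] ℂ⟦X⟧ p = p := fun p => by
      simp [PowerSeries.algebraMap_apply']
    simp only [map_sub, map_pow, map_mul, Polynomial.aeval_C, Polynomial.aeval_X]
    simp only [hmap, Polynomial.coe_add, Polynomial.coe_mul, Polynomial.coe_one, Polynomial.coe_X, coe_ofNat_powerSeries]
    linear_combination (2 * (1 + PowerSeries.X) ^ 3 * genFun1342 -
      (1 + 20 * PowerSeries.X - 8 * PowerSeries.X ^ 2) + (1 - 8 * PowerSeries.X) * sqrtSeries) * hF +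
      (1 - 8 * PowerSeries.X) ^ 2 * sqrtSeries_sq

/-- `1 - 8x` is not the square of a rational function, as its degree is odd. -/
lemma not_isRationalSeries_sqrtSeries : ¬ IsRationalSeries sqrtSeries := by
  rintro ⟨A, D, hD, h⟩
  have hsq : D ^ 2 * (1 - 8 * Polynomial.X) = A ^ 2 := by
    apply Polynomial.coe_injective ℂ
    simp only [Polynomial.coe_sub, Polynomial.coe_mul, Polynomial.coe_pow, Polynomial.coe_one,
      Polynomial.coe_X, coe_ofNat_powerSeries]
    rw [← h, ← sqrtSeries_sq, mul_pow]
  have hlin : (1 - 8 * Polynomial.X : ℂ[X]) = Polynomial.C (-8) * Polynomial.X + Polynomial.C 1 := by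
    simp only [map_neg, map_ofNat, map_one]
    ring
  have hdeg : (1 - 8 * Polynomial.X : ℂ[X]).natDegree = 1 := by
    rw [hlin, Polynomial.natDegree_linear (by norm_num)]
  have hne : (1 - 8 * Polynomial.X : ℂ[X]) ≠ 0 := fun h0 => by simp [h0] at hdeg
  have := congrArg Polynomial.natDegree hsq
  rw [Polynomial.natDegree_mul (pow_ne_zero 2 hD) hne, Polynomial.natDegree_pow,
    Polynomial.natDegree_pow, hdeg] at this
  omega

theorem mainTheorem5 :
    IsPRecursive (fun n => (avoidCount pattern1342 n : ℂ)) ∧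
    IsAlgebraic ℂ[X] genFun1342 ∧
    ∃ r : ℂ⟦X⟧, IsSqrtOneSubEight r ∧ IsOnlyQuadraticIrrationality r genFun1342 := by
  refine ⟨isPRecursive_avoidCount, isAlgebraic_genFun1342, sqrtSeries,
    ⟨constantCoeff_sqrtSeries, sqrtSeries_sq⟩, ?_, 1 + 20 * Polynomial.X - 8 * Polynomial.X ^ 2,
    1 - 8 * Polynomial.X, 2 * (1 + Polynomial.X) ^ 3, ?_, ?_⟩
  · rintro ⟨A, D, hD, h⟩
    refine not_isRationalSeries_sqrtSeries ⟨2 * (1 + Polynomial.X) ^ 3 * A -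
      D * (1 + 20 * Polynomial.X - 8 * Polynomial.X ^ 2), D * (1 - 8 * Polynomial.X), ?_, ?_⟩
    · refine mul_ne_zero hD fun h0 => ?_
      have := congrArg (Polynomial.eval 0) h0
      simp at this
    · have hF := genFun1342_closed_form
      simp only [Polynomial.coe_sub, Polynomial.coe_add, Polynomial.coe_mul, Polynomial.coe_pow,
        Polynomial.coe_one, Polynomial.coe_X, coe_ofNat_powerSeries]
      linear_combination -(D : ℂ⟦X⟧) * hF + 2 * (1 + PowerSeries.X) ^ 3 * h
  · intro h0
    have := congrArg (Polynomial.eval 0) h0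
    simp at this
  · simp only [Polynomial.coe_sub, Polynomial.coe_add, Polynomial.coe_mul, Polynomial.coe_pow,
      Polynomial.coe_one, Polynomial.coe_X, coe_ofNat_powerSeries]
    exact genFun1342_closed_form
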